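/- For $x\in\{0,1\}^n$ write $|x|=\sum_i x_i$ and $\mathrm{parity}(x)=(-1)^{|x|}$. A parity decision tree is a binary tree each of whose inner nodes queries the parity $\sum_{i\in S}x_i \bmod 2$ of some set $S\subseteq[n]$ of variables and each of whose leaves is labelled by an output in $\{-1,1\}$; an ordinary decision tree queries single variables only. The size of a tree is its number of leaves, and the (parity) decision tree size of $f$ is the minimum size of a (parity) decision tree that computes $f$. For a symmetric function $f:\{0,1\}^n\to\{-1,1\}$ (one invariant under permutations of the coordinates) let $0\le r_0,r_1\le n/2$ be minimum integers such that $f(x)$ or $f(x)\cdot\mathrm{parity}(x)$ is constant for all $x$ with $|x|\in[r_0,n-r_1]$ (that is, $(r_0,r_1)$ is any such pair that is minimal in the coordinatewise order), and let $r(f)=\max\{r_0,r_1\}$. There are absolute constants $c,C>0$ such that for every $n\ge 0$ and every symmetric $f:\{0,1\}^n\to\{-1,1\}$, with $r=r(f)$ and with the convention $r\log_2(n/r)=0$ for $r=0$: (i) the parity decision tree size of $f$ is at least $2^{c\,r\log_2(n/r)}$, and so is its ordinary decision tree size; (ii) if $r\ge 1$, the parity decision tree size of $f$ is at most $2^{C\,r\log_2(n/r)}$,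 and if $r=0$, it is at most $2$; (iii) the parity decision tree size of $f$ is at most $4\binom{n}{r_0}+4\binom{n}{r_1}$. In particular, for $r(f)\ge 1$ the parity decision tree size of $f$ is $2^{\Theta(r(f)\log(n/r(f)))}$. -/

import Mathlib

/-! Boolean functions on the cube `{0,1}^n`, written as `Fin n → ZMod 2`, with values in
`{-1, 1}`, written as `ℤˣ`. -/

/-- The Hamming weight `|x| = ∑ x_i`, the number of coordinates equal to `1`. -/
def hammingWeight {n : ℕ} (x : Fin n → ZMod 2) : ℕ :=
  (Finset.univ.filter fun i => x i = 1).card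

/-- The parity function `x ↦ (-1)^|x|`. -/
def parityFun {n : ℕ} (x : Fin n → ZMod 2) : ℤˣ :=
  (-1) ^ hammingWeight x

/-- A function on the cube is symmetric if it is invariant under permutations of the
coordinates. -/
def IsSymmetricFun {n : ℕ} (f : (Fin n → ZMod 2) → ℤˣ) : Prop :=
  ∀ (σ : Equiv.Perm (Fin n)) (x : Fin n → ZMod 2), f (x ∘ σ) = f x

/-- `g` is constant on the points `x` with `|x| ∈ [a, n - b]`. -/
def ConstantOnWindow {n : ℕ} (g : (Fin n → ZMod 2) → ℤˣ) (a b : ℕ) : Prop :=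
  ∀ x y : Fin n → ZMod 2,
    a ≤ hammingWeight x → hammingWeight x + b ≤ n →
    a ≤ hammingWeight y → hammingWeight y + b ≤ n → g x = g y

/-- The pair `p = (a, b)` of integers `0 ≤ a, b ≤ n / 2` is admissible for `f` if `f` or
`f · parity` is constant on the points `x` with `|x| ∈ [a, n - b]`. -/
def IsAdmissiblePair {n : ℕ} (f : (Fin n → ZMod 2) → ℤˣ) (p : ℕ × ℕ) : Prop :=
  2 * p.1 ≤ n ∧ 2 * p.2 ≤ n ∧
    (ConstantOnWindow f p.1 p.2 ∨ ConstantOnWindow (fun x => f x * parityFun x) p.1 p.2)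

/-- `r₀` and `r₁` are the minimum integers such that `(r₀, r₁)` is admissible for `f`
(minimality is in the product order). -/
def IsMinimalPair {n : ℕ} (f : (Fin n → ZMod 2) → ℤˣ) (r₀ r₁ : ℕ) : Prop :=
  Minimal (IsAdmissiblePair f) (r₀, r₁)

/-- Parity decision trees on `n` variables: a leaf is labelled by an output, an inner node
by the set `S` of variables whose parity is queried; the first subtree is entered if
`∑ i ∈ S, x i = 0` and the second one if `∑ i ∈ S, x i = 1`. -/
inductive ParityDecisionTree (n : ℕ) : Type
  | leaf (v : ℤˣ) : ParityDecisionTree n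
  | node (S : Finset (Fin n)) (t₀ t₁ : ParityDecisionTree n) : ParityDecisionTree n

namespace ParityDecisionTree

/-- The output of a parity decision tree on the input `x`. -/
def eval {n : ℕ} : ParityDecisionTree n → (Fin n → ZMod 2) → ℤˣ
  | leaf v, _ => v
  | node S t₀ t₁, x => if ∑ i ∈ S, x i = 0 then t₀.eval x else t₁.eval x

/-- The size of a tree is the number of its leaves. -/
def size {n : ℕ} : ParityDecisionTree n → ℕ
  | leaf _ => 1
  | node _ t₀ t₁ => t₀.size + t₁.size

/-- An ordinary decision tree is a tree all of whose queries are single variables. -/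
def IsOrdinary {n : ℕ} : ParityDecisionTree n → Prop
  | leaf _ => True
  | node S t₀ t₁ => (∃ i, S = {i}) ∧ t₀.IsOrdinary ∧ t₁.IsOrdinary

/-- The tree `t` computes the function `f`. -/
def Computes {n : ℕ} (t : ParityDecisionTree n) (f : (Fin n → ZMod 2) → ℤˣ) : Prop :=
  ∀ x, t.eval x = f x

/-- Every function is computed by some ordinary decision tree, so that the two minima below
are minima of non-empty sets. -/
theorem exists_isOrdinary_computes {n : ℕ} (f : (Fin n → ZMod 2) → ℤˣ) :
    ∃ t : ParityDecisionTree n, t.IsOrdinary ∧ t.Computes f := by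
  suffices h : ∀ (s : Finset (Fin n)) (f : (Fin n → ZMod 2) → ℤˣ),
      (∀ x y, (∀ i ∈ s, x i = y i) → f x = f y) →
      ∃ t : ParityDecisionTree n, t.IsOrdinary ∧ t.Computes f by
    exact h Finset.univ f fun x y hxy =>
      congrArg f (funext fun i => hxy i (Finset.mem_univ i))
  intro s
  induction s using Finset.induction_on with
  | empty =>
    intro f hf
    exact ⟨leaf (f 0), trivial, fun x => hf 0 x (by simp)⟩
  | insert i s _ ih =>
    intro f hf
    have key : ∀ b : ZMod 2, ∃ t : ParityDecisionTree n, t.IsOrdinary ∧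
        t.Computes (fun x => f (Function.update x i b)) := by
      intro b
      refine ih _ fun x y hxy => hf _ _ fun j hj => ?_
      by_cases hji : j = i
      · subst hji; simp
      · simp [Function.update_of_ne hji,
          hxy j ((Finset.mem_insert.mp hj).resolve_left hji)]
    obtain ⟨t₀, ho₀, hc₀⟩ := key 0
    obtain ⟨t₁, ho₁, hc₁⟩ := key 1
    refine ⟨node {i} t₀ t₁, ⟨⟨i, rfl⟩, ho₀, ho₁⟩, fun x => ?_⟩
    have h01 : ∀ z : ZMod 2, z ≠ 0 → z = 1 := by decide
    by_cases hx : x i = 0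
    · have : Function.update x i 0 = x := by rw [← hx]; exact Function.update_eq_self i x
      simp [eval, hx, hc₀ x, this]
    · have : Function.update x i 1 = x := by
        rw [← h01 _ hx]; exact Function.update_eq_self i x
      simp [eval, hx, hc₁ x, this]

end ParityDecisionTree

/-- The parity decision tree size of `f`: the minimum number of leaves of a parity decision
tree that computes `f`. -/
noncomputable def parityTreeSize {n : ℕ} (f : (Fin n → ZMod 2) → ℤˣ) : ℕ :=
  sInf {s | ∃ t : ParityDecisionTree n, t.Computes f ∧ t.size = s}

/-- The decision tree size of `f`: the minimum number of leaves of an ordinary decision tree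
that computes `f`. -/
noncomputable def decisionTreeSize {n : ℕ} (f : (Fin n → ZMod 2) → ℤˣ) : ℕ :=
  sInf {s | ∃ t : ParityDecisionTree n, t.IsOrdinary ∧ t.Computes f ∧ t.size = s}

/-- For a symmetric function there is a pair of minimum integers `r₀`, `r₁`. -/
theorem IsSymmetricFun.exists_isMinimalPair {n : ℕ} {f : (Fin n → ZMod 2) → ℤˣ}
    (hf : IsSymmetricFun f) : ∃ r₀ r₁ : ℕ, IsMinimalPair f r₀ r₁ := by
  have heq : ∀ x y : Fin n → ZMod 2, hammingWeight x = hammingWeight y → f x = f y := by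
    intro x y hxy
    have hcard : Fintype.card {i // x i = 1} = Fintype.card {i // y i = 1} := by
      rw [Fintype.card_subtype, Fintype.card_subtype]; exact hxy
    let e : {i // x i = 1} ≃ {i // y i = 1} := Fintype.equivOfCardEq hcard
    have h01 : ∀ z : ZMod 2, z ≠ 1 → z = 0 := by decide
    rw [← hf e.extendSubtype y]
    congr 1
    funext i
    by_cases hi : x i = 1
    · exact hi.trans (e.extendSubtype_mem i hi).symm
    · exact (h01 _ hi).trans (h01 _ (e.extendSubtype_not_mem i hi)).symm
  have hpar : ∀ k l : ℕ, k < l → l ≤ k + 1 → ((-1 : ℤˣ)) ^ l = - (-1) ^ k := by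
    intro k l h1 h2
    obtain rfl : l = k + 1 := by omega
    rw [pow_succ]; simp
  have hne : ∃ p, IsAdmissiblePair f p := by
    refine ⟨(n / 2, n / 2), by simp only; omega, by simp only; omega, ?_⟩
    by_cases h : ConstantOnWindow f (n / 2) (n / 2)
    · exact Or.inl h
    · refine Or.inr fun x y hx hx' hy hy' => ?_
      by_cases hw : hammingWeight x = hammingWeight y
      · simp only [parityFun, hw, heq x y hw]
      · have hxy : f x ≠ f y := by
          intro hxy
          refine h fun u v hu hu' hv hv' => ?_
          have cu : hammingWeight u = hammingWeight x ∨ hammingWeight u = hammingWeight y := by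
            omega
          have cv : hammingWeight v = hammingWeight x ∨ hammingWeight v = hammingWeight y := by
            omega
          rcases cu with cu | cu <;> rcases cv with cv | cv <;>
            rw [heq _ _ cu, heq _ _ cv] <;> simp [hxy]
        have hp : parityFun x = - parityFun y := by
          rcases lt_or_gt_of_ne hw with hlt | hlt
          · have := hpar _ _ hlt (by omega)
            simp only [parityFun, this, neg_neg]
          · exact hpar _ _ hlt (by omega)
        have hfn : f x = - f y := by
          rcases Int.units_eq_one_or (f x) with h1 | h1 <;>
            rcases Int.units_eq_one_or (f y) with h2 | h2 <;> simp_all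
        simp only [hp, hfn, neg_mul_neg]
  obtain ⟨p, hp⟩ := exists_minimal_of_wellFoundedLT (IsAdmissiblePair f) hne
  exact ⟨p.1, p.2, hp⟩

/-! Upper bound. If both ends of the window are at most `n / 3`, read variables one at a time until
`r₀` ones and `r₁` zeros have been seen; the leaves are counted by partial binomial sums, which the
last term dominates. If it is `f · parity` that is constant on the window, query the full parity
first. If an end `r` exceeds `n / 3`, a tree that finds the weight itself is good enough: it reads
the variables in pairs, parity first, with three outcomes per pair, and `3 ^ (n / 2)` is below a
multiple of `n.choose r`.

Lower bound. Ordinary trees are parity trees, so only the latter matter. After complementing the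
input if necessary, `r = r₀`. By minimality the value on layer `r - 1` differs from the value on
every layer of the window with the same parity (`LayerAdmissible.jump`).

For `n ≥ 64 * r` put `k = r - 1`. The inputs reaching a leaf form an affine subspace. Inside the
points of the parity of `k`, if it meets layer `k`, its points of weight at most `k` are again an
affine subspace, since a sum of three of them is too light to lie beyond the window. An affine
subspace of weights at most `k` has at most `4 ^ k` points, so there are at least `n.choose k / 4 ^
k` leaves (`choose_le_size_mul_four_pow`). For `k = 0` this says nothing, and the length of the path
of the input `0` is used instead.

For `n < 64 * r` a bound exponential in `r` is needed, and the single jump between the layers `r -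
1` and `r + 1` yields it. Fixing variables moves the jump to the middle of a cube of dimension `240
* L`. A tree of size `s` has correlation at most `s * M` with any `g` whose Fourier coefficients are
at most `M`. Take `g` symmetric, supported on odd layers near the middle, and annihilating
polynomials of degree at most `2 * L` in the weight. Its low coefficients vanish because normalised
Krawtchouk values are polynomials in the weight, its high ones by complementation, and the middle
ones are tiny by Parseval. A dual functional with most of its mass next to the jump makes the
correlation with `f` large (`two_pow_le_size_of_middle_jump`). -/

/-! ### Weights on subsets and partial sums of binomial coefficients -/

/-- The number of coordinates in `s` at which `x` equals `1`. -/
def weightOn {n : ℕ} (s : Finset (Fin n)) (x : Fin n → ZMod 2) : ℕ :=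
  (s.filter fun i => x i = 1).card

theorem weightOn_univ {n : ℕ} (x : Fin n → ZMod 2) :
    weightOn Finset.univ x = hammingWeight x := rfl

theorem weightOn_insert_zero {n : ℕ} {s : Finset (Fin n)} {i : Fin n} {x : Fin n → ZMod 2}
    (hx : x i = 0) : weightOn (insert i s) x = weightOn s x := by
  simp [weightOn, Finset.filter_insert, hx]

theorem weightOn_insert_one {n : ℕ} {s : Finset (Fin n)} {i : Fin n} (hi : i ∉ s)
    {x : Fin n → ZMod 2} (hx : x i = 1) : weightOn (insert i s) x = weightOn s x + 1 := by
  simp [weightOn, Finset.filter_insert, hx, hi]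

theorem weightOn_le {n : ℕ} (s : Finset (Fin n)) (x : Fin n → ZMod 2) :
    weightOn s x ≤ s.card := Finset.card_filter_le _ _

theorem ZMod.two_eq_one_of_ne_zero : ∀ {z : ZMod 2}, z ≠ 0 → z = 1 := by decide

/-- The number of subsets of size at most `a` of a set of size `m`. -/
def chooseSum (m a : ℕ) : ℕ := ∑ i ∈ Finset.range (a + 1), m.choose i

theorem chooseSum_zero (m : ℕ) : chooseSum m 0 = 1 := by simp [chooseSum]

theorem chooseSum_pos (m a : ℕ) : 1 ≤ chooseSum m a := by
  rw [chooseSum, Finset.sum_range_succ']; simp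

theorem chooseSum_succ_succ (m a : ℕ) :
    chooseSum (m + 1) (a + 1) = chooseSum m a + chooseSum m (a + 1) := by
  simp only [chooseSum]
  rw [Finset.sum_range_succ', Finset.sum_range_succ' _ (a + 1)]
  simp only [Nat.choose_succ_succ, Finset.sum_add_distrib, Nat.choose_zero_right]
  ring

/-- In the lowest third of the layers the binomial coefficients at least double at each step, so the
sum is dominated geometrically by its last term. -/
theorem chooseSum_le_two_mul_choose {m : ℕ} : ∀ {a : ℕ}, 3 * a ≤ m + 1 →
    chooseSum m a ≤ 2 * m.choose a
  | 0, _ => by simp [chooseSum]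
  | a + 1, h => by
    have ih := chooseSum_le_two_mul_choose (m := m) (a := a) (by omega)
    have h1 : chooseSum m (a + 1) = chooseSum m a + m.choose (a + 1) := by
      simp only [chooseSum]; rw [Finset.sum_range_succ _ (a + 1)]
    have h2 := Nat.choose_succ_right_eq m a
    have h3 : 2 * m.choose a ≤ m.choose (a + 1) := by
      have h4 : 2 * (a + 1) ≤ m - a := by omega
      have h5 : m.choose a * (2 * (a + 1)) ≤ m.choose (a + 1) * (a + 1) := by
        rw [h2]; exact Nat.mul_le_mul_left _ h4
      refine Nat.le_of_mul_le_mul_right (c := a + 1) ?_ (Nat.succ_pos a)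
      linarith
    omega

/-! ### The two trees of the upper bound -/

namespace ParityDecisionTree

/-- Querying one variable after the other, until `a` ones and `b` zeros have been seen. -/
theorem exists_eval_eq_of_constant {n : ℕ} (s : Finset (Fin n)) :
    ∀ (G : ℕ → ℤˣ) (a b : ℕ),
      (∀ u v, a ≤ u → u + b ≤ s.card → a ≤ v → v + b ≤ s.card → G u = G v) →
      ∃ t : ParityDecisionTree n, (∀ x, t.eval x = G (weightOn s x)) ∧
        t.size + 1 ≤ chooseSum s.card a + chooseSum s.card b := by
  induction s using Finset.induction_on with
  | empty =>
    intro G a b _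
    refine ⟨leaf (G 0), fun x => by simp [eval, weightOn], ?_⟩
    have h1 := chooseSum_pos 0 a
    have h2 := chooseSum_pos 0 b
    simp only [size, Finset.card_empty]; omega
  | insert i s hi ih =>
    intro G a b hG
    rw [Finset.card_insert_of_notMem hi] at hG ⊢
    by_cases hab : a = 0 ∧ b = 0
    · obtain ⟨rfl, rfl⟩ := hab
      refine ⟨leaf (G 0), fun x => ?_, by simp [size, chooseSum_zero]⟩
      have := weightOn_le (insert i s) x
      rw [Finset.card_insert_of_notMem hi] at this
      exact hG _ _ (by omega) (by omega) (by omega) (by omega)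
    obtain ⟨t₀, h₀, hs₀⟩ := ih G a (b - 1) fun u v h1 h2 h3 h4 =>
      hG u v h1 (by omega) h3 (by omega)
    obtain ⟨t₁, h₁, hs₁⟩ := ih (fun w => G (w + 1)) (a - 1) b fun u v h1 h2 h3 h4 =>
      hG (u + 1) (v + 1) (by omega) (by omega) (by omega) (by omega)
    refine ⟨node {i} t₀ t₁, fun x => ?_, ?_⟩
    · by_cases hx : x i = 0
      · simp [eval, hx, h₀, weightOn_insert_zero hx]
      · simp [eval, hx, h₁, weightOn_insert_one hi (ZMod.two_eq_one_of_ne_zero hx)]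
    · simp only [size]
      -- For `a = 0` or `b = 0` the summand `chooseSum _ 0 = 1` is not split by Pascal's rule; the
      -- `+ 1` in the claimed bound pays for that.
      rcases a with _ | a <;> rcases b with _ | b
      · simp at hab
      · simp only [Nat.add_sub_cancel, zero_tsub, chooseSum_zero, chooseSum_succ_succ] at *
        omega
      · simp only [Nat.add_sub_cancel, zero_tsub, chooseSum_zero, chooseSum_succ_succ] at *
        omega
      · simp only [Nat.add_sub_cancel, chooseSum_succ_succ] at *
        omega

/-- Querying the variables in pairs: first the parity of the pair, and one of its elements
only if the parity is even. -/
theorem exists_eval_eq_pairs {n : ℕ} :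
    ∀ (m : ℕ) (s : Finset (Fin n)), s.card = m → ∀ G : ℕ → ℤˣ,
      ∃ t : ParityDecisionTree n, (∀ x, t.eval x = G (weightOn s x)) ∧
        t.size ≤ 3 ^ (m / 2) * 2 ^ (m % 2)
  | 0, s, hs, G => by
    obtain rfl := Finset.card_eq_zero.mp hs
    exact ⟨leaf (G 0), fun x => by simp [eval, weightOn], by simp [size]⟩
  | 1, s, hs, G => by
    obtain ⟨i, rfl⟩ := Finset.card_eq_one.mp hs
    refine ⟨node {i} (leaf (G 0)) (leaf (G 1)), fun x => ?_, by simp [size]⟩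
    by_cases hx : x i = 0
    · simp [eval, hx, weightOn, Finset.filter_singleton]
    · simp [eval, weightOn, Finset.filter_singleton, ZMod.two_eq_one_of_ne_zero hx]
  | m + 2, s, hs, G => by
    obtain ⟨i, s₁, hi, rfl, hs₁⟩ := Finset.card_eq_succ.mp hs
    obtain ⟨j, s₂, hj, rfl, hs₂⟩ := Finset.card_eq_succ.mp hs₁
    obtain ⟨t₀, h₀, hs₀⟩ := exists_eval_eq_pairs m s₂ hs₂ G
    obtain ⟨t₁, h₁, hs₁'⟩ := exists_eval_eq_pairs m s₂ hs₂ fun w => G (w + 1)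
    obtain ⟨t₂, h₂, hs₂'⟩ := exists_eval_eq_pairs m s₂ hs₂ fun w => G (w + 2)
    have hij : i ≠ j := by rintro rfl; exact hi (Finset.mem_insert_self _ _)
    have h11 : (1 : ZMod 2) + 1 = 0 := by decide
    refine ⟨node {i, j} (node {i} t₀ t₂) t₁, fun x => ?_, ?_⟩
    · by_cases hx : x i = 0 <;> by_cases hy : x j = 0
      · simp [eval, Finset.sum_pair hij, hx, hy, h₀, weightOn_insert_zero]
      · have hy := ZMod.two_eq_one_of_ne_zero hy
        simp [eval, Finset.sum_pair hij, hx, hy, h₁, weightOn_insert_zero hx,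
          weightOn_insert_one hj hy]
      · have hx := ZMod.two_eq_one_of_ne_zero hx
        simp [eval, Finset.sum_pair hij, hx, hy, h₁, weightOn_insert_zero hy,
          weightOn_insert_one hi hx]
      · have hx := ZMod.two_eq_one_of_ne_zero hx
        have hy := ZMod.two_eq_one_of_ne_zero hy
        simp [eval, Finset.sum_pair hij, hx, hy, h₂, h11, weightOn_insert_one hj hy,
          weightOn_insert_one hi hx, add_assoc]
    · have e1 : (m + 2) / 2 = m / 2 + 1 := by omega
      have e2 : (m + 2) % 2 = m % 2 := by omega
      rw [e1, e2, pow_succ]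
      simp only [size]
      linarith

/-- The tree with all outputs negated. -/
def neg {n : ℕ} : ParityDecisionTree n → ParityDecisionTree n
  | leaf v => leaf (-v)
  | node S t₀ t₁ => node S t₀.neg t₁.neg

theorem eval_neg {n : ℕ} (t : ParityDecisionTree n) (x : Fin n → ZMod 2) :
    t.neg.eval x = - t.eval x := by
  induction t with
  | leaf v => rfl
  | node S t₀ t₁ h₀ h₁ => simp only [neg, eval, h₀, h₁]; split <;> rfl

theorem size_neg {n : ℕ} (t : ParityDecisionTree n) : t.neg.size = t.size := by
  induction t with
  | leaf v => rfl
  | node S t₀ t₁ h₀ h₁ => simp only [neg, size, h₀, h₁]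

theorem one_le_size {n : ℕ} (t : ParityDecisionTree n) : 1 ≤ t.size := by
  induction t with
  | leaf v => exact le_rfl
  | node S t₀ t₁ h₀ h₁ => simp only [size]; omega

end ParityDecisionTree

/-! ### Parity, minimal trees, and symmetric functions as functions of the weight -/

theorem sum_eq_natCast_weightOn {n : ℕ} (s : Finset (Fin n)) (x : Fin n → ZMod 2) :
    ∑ i ∈ s, x i = (weightOn s x : ZMod 2) := by
  rw [weightOn, Finset.card_filter, Nat.cast_sum]
  refine Finset.sum_congr rfl fun i _ => ?_
  by_cases hx : x i = 0
  · simp [hx]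
  · simp [ZMod.two_eq_one_of_ne_zero hx]

theorem parityFun_eq_ite {n : ℕ} (x : Fin n → ZMod 2) :
    parityFun x = if ∑ i, x i = 0 then 1 else -1 := by
  rw [sum_eq_natCast_weightOn, weightOn_univ, parityFun]
  simp only [ZMod.natCast_eq_zero_iff_even]
  split_ifs with h
  · exact h.neg_one_pow
  · exact (Nat.not_even_iff_odd.mp h).neg_one_pow

theorem parityTreeSize_le {n : ℕ} {f : (Fin n → ZMod 2) → ℤˣ} {t : ParityDecisionTree n}
    (ht : t.Computes f) : parityTreeSize f ≤ t.size :=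
  Nat.sInf_le ⟨t, ht, rfl⟩

theorem exists_computes_size_eq {n : ℕ} (f : (Fin n → ZMod 2) → ℤˣ) :
    ∃ t : ParityDecisionTree n, t.Computes f ∧ t.size = parityTreeSize f := by
  obtain ⟨t, -, ht⟩ := ParityDecisionTree.exists_isOrdinary_computes f
  exact Nat.sInf_mem (s := {s | ∃ t : ParityDecisionTree n, t.Computes f ∧ t.size = s})
    ⟨_, t, ht, rfl⟩

theorem parityTreeSize_le_decisionTreeSize {n : ℕ} (f : (Fin n → ZMod 2) → ℤˣ) :
    parityTreeSize f ≤ decisionTreeSize f := by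
  obtain ⟨t, ho, ht⟩ := ParityDecisionTree.exists_isOrdinary_computes f
  obtain ⟨t', -, ht', hs⟩ := Nat.sInf_mem
    (s := {s | ∃ t : ParityDecisionTree n, t.IsOrdinary ∧ t.Computes f ∧ t.size = s})
    ⟨_, t, ho, ht, rfl⟩
  exact (parityTreeSize_le ht').trans_eq hs

/-- A symmetric function depends on the Hamming weight only. -/
theorem IsSymmetricFun.eq_of_hammingWeight_eq {n : ℕ} {f : (Fin n → ZMod 2) → ℤˣ}
    (hf : IsSymmetricFun f) {x y : Fin n → ZMod 2} (hxy : hammingWeight x = hammingWeight y) :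
    f x = f y := by
  have hcard : Fintype.card {i // x i = 1} = Fintype.card {i // y i = 1} := by
    rw [Fintype.card_subtype, Fintype.card_subtype]; exact hxy
  let e : {i // x i = 1} ≃ {i // y i = 1} := Fintype.equivOfCardEq hcard
  have h01 : ∀ z : ZMod 2, z ≠ 1 → z = 0 := by decide
  rw [← hf e.extendSubtype y]
  congr 1
  funext i
  by_cases hi : x i = 1
  · exact hi.trans (e.extendSubtype_mem i hi).symm
  · exact (h01 _ hi).trans (h01 _ (e.extendSubtype_not_mem i hi)).symm

theorem IsSymmetricFun.exists_eq_hammingWeight {n : ℕ} {f : (Fin n → ZMod 2) → ℤˣ}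
    (hf : IsSymmetricFun f) : ∃ F : ℕ → ℤˣ, ∀ x, f x = F (hammingWeight x) := by
  classical
  refine ⟨fun w => if h : ∃ x, hammingWeight x = w then f h.choose else 1, fun x => ?_⟩
  have h : ∃ y : Fin n → ZMod 2, hammingWeight y = hammingWeight x := ⟨x, rfl⟩
  simp only [h, dite_true]
  exact hf.eq_of_hammingWeight_eq h.choose_spec.symm

/-- The point of the cube with support `U`. -/
def cubePoint {n : ℕ} (U : Finset (Fin n)) : Fin n → ZMod 2 := fun i => if i ∈ U then 1 else 0

theorem weightOn_cubePoint {n : ℕ} (s U : Finset (Fin n)) :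
    weightOn s (cubePoint U) = (s ∩ U).card := by
  simp only [weightOn, cubePoint]
  congr 1
  ext i
  by_cases h : i ∈ U <;> simp [h]

theorem hammingWeight_cubePoint {n : ℕ} (U : Finset (Fin n)) :
    hammingWeight (cubePoint U) = U.card := by
  rw [← weightOn_univ, weightOn_cubePoint, Finset.univ_inter]

theorem exists_hammingWeight_eq {n w : ℕ} (hw : w ≤ n) :
    ∃ x : Fin n → ZMod 2, hammingWeight x = w := by
  obtain ⟨U, -, hU⟩ := Finset.exists_subset_card_eq (s := (Finset.univ : Finset (Fin n)))
    (n := w) (by simpa using hw)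
  exact ⟨cubePoint U, by rw [hammingWeight_cubePoint, hU]⟩

theorem hammingWeight_le {n : ℕ} (x : Fin n → ZMod 2) : hammingWeight x ≤ n := by
  simpa [weightOn_univ] using weightOn_le Finset.univ x

/-! ### Binomial coefficients against the size of the pair tree -/

theorem choose_le_choose_of_le_half {n k l : ℕ} (hkl : k ≤ l) (hl : 2 * l ≤ n) :
    n.choose k ≤ n.choose l := by
  induction l, hkl using Nat.le_induction with
  | base => exact le_rfl
  | succ l _ ih =>
    exact (ih (by omega)).trans (Nat.choose_le_succ_of_lt_half_left (by omega))

theorem choose_add_three_mul (r N : ℕ) :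
    (r + N + 3).choose (r + 1) * ((r + 1) * (N + 2) * (N + 1)) =
      (r + N).choose r * ((r + N + 3) * (r + N + 2) * (r + N + 1)) := by
  have h1 := Nat.add_one_mul_choose_eq (r + N + 2) r
  have h2 := Nat.choose_mul_succ_eq (r + N + 1) r
  have h3 := Nat.choose_mul_succ_eq (r + N) r
  rw [show r + N + 1 + 1 - r = N + 2 by omega] at h2
  rw [show r + N + 1 - r = N + 1 by omega] at h3
  calc _ = (r + N + 3).choose (r + 1) * (r + 1) * (N + 2) * (N + 1) := by ring
    _ = (r + N + 3) * ((r + N + 1 + 1).choose r * (N + 2)) * (N + 1) := by rw [← h1]; ring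
    _ = (r + N + 3) * (r + N + 2) * ((r + N + 1).choose r * (N + 1)) := by rw [← h2]; ring
    _ = _ := by rw [← h3]; ring

/-- The ratio tends to `27 / 4`; the value `26 / 5` already holds for `k = 1` and its square `27.04`
still exceeds `27`. -/
theorem twentysix_mul_choose_le {k j : ℕ} (hk : 1 ≤ k) (hj : j < 3) :
    26 * (3 * k + j).choose (k + 1) ≤ 5 * (3 * (k + 1) + j).choose (k + 2) := by
  obtain ⟨i, rfl⟩ : ∃ i, k = i + 1 := ⟨k - 1, by omega⟩
  have h := choose_add_three_mul (i + 1 + 1) (2 * i + 1 + j)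
  rw [show i + 1 + 1 + (2 * i + 1 + j) = 3 * (i + 1) + j by ring] at h
  rw [show 3 * (i + 1 + 1) + j = 3 * (i + 1) + j + 3 by ring]
  set A := (3 * (i + 1) + j).choose (i + 1 + 1)
  set B := (3 * (i + 1) + j + 3).choose (i + 1 + 1 + 1)
  set p := (i + 1 + 1 + 1) * (2 * i + 1 + j + 2) * (2 * i + 1 + j + 1) with hp
  set q := (3 * (i + 1) + j + 3) * (3 * (i + 1) + j + 2) * (3 * (i + 1) + j + 1) with hq
  have hpq : 26 * p ≤ 5 * q := by
    rw [hp, hq]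
    interval_cases j <;> nlinarith [Nat.zero_le (i ^ 3), Nat.zero_le (i ^ 2), Nat.zero_le i]
  have hp0 : 0 < p := by positivity
  refine Nat.le_of_mul_le_mul_right (c := p) ?_ hp0
  calc 26 * A * p = A * (26 * p) := by ring
    _ ≤ A * (5 * q) := Nat.mul_le_mul_left _ hpq
    _ = 5 * B * p := by linarith

/-- Induction in steps of `6` in the dimension: the left side grows by `3 ^ 3 = 27`, the right side
by at least `(26 / 5) ^ 2`. -/
theorem pairs_size_le_choose_third {j : ℕ} (hj : j < 3) : ∀ k : ℕ,
    3 ^ ((3 * (k + 1) + j) / 2) * 2 ^ ((3 * (k + 1) + j) % 2) ≤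
      4 * (3 * (k + 1) + j).choose (k + 2)
  | 0 => by interval_cases j <;> simp [Nat.choose]
  | 1 => by interval_cases j <;> simp [Nat.choose]
  | k + 2 => by
    have ih := pairs_size_le_choose_third hj k
    have h1 := twentysix_mul_choose_le (k := k + 1) (by omega) hj
    have h2 := twentysix_mul_choose_le (k := k + 2) (by omega) hj
    rw [show (3 * (k + 2 + 1) + j) / 2 = (3 * (k + 1) + j) / 2 + 3 by omega,
      show (3 * (k + 2 + 1) + j) % 2 = (3 * (k + 1) + j) % 2 by omega, pow_add]
    simp only [add_assoc, Nat.reduceAdd] at *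
    linarith

/-- The size of the tree that queries pairs is small compared to the binomial coefficients
in the middle third. -/
theorem pairs_size_le_choose {n r : ℕ} (h1 : n < 3 * r) (h2 : 2 * r ≤ n) :
    3 ^ (n / 2) * 2 ^ (n % 2) ≤ 4 * n.choose r := by
  rcases lt_or_ge n 3 with hn | hn
  · obtain ⟨rfl, rfl⟩ : n = 2 ∧ r = 1 := by omega
    simp
  · obtain ⟨k, j, hj, rfl⟩ : ∃ k j, j < 3 ∧ n = 3 * (k + 1) + j :=
      ⟨n / 3 - 1, n % 3, by omega, by omega⟩
    exact (pairs_size_le_choose_third hj k).trans (Nat.mul_le_mul_left _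
      (choose_le_choose_of_le_half (by omega) h2))

/-! ### The upper bounds -/

theorem ConstantOnWindow.eq_of_le {n : ℕ} {g : (Fin n → ZMod 2) → ℤˣ} {a b : ℕ}
    (h : ConstantOnWindow g a b) {G : ℕ → ℤˣ} (hG : ∀ x, g x = G (hammingWeight x)) (u v : ℕ)
    (hu : a ≤ u) (hu' : u + b ≤ n) (hv : a ≤ v) (hv' : v + b ≤ n) : G u = G v := by
  obtain ⟨x, rfl⟩ := exists_hammingWeight_eq (n := n) (w := u) (by omega)
  obtain ⟨y, rfl⟩ := exists_hammingWeight_eq (n := n) (w := v) (by omega)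
  rw [← hG, ← hG]
  exact h x y hu hu' hv hv'

theorem parityTreeSize_le_choose {n : ℕ} {f : (Fin n → ZMod 2) → ℤˣ} (hf : IsSymmetricFun f)
    {a b : ℕ} (hab : IsAdmissiblePair f (a, b)) :
    parityTreeSize f ≤ 4 * n.choose a + 4 * n.choose b := by
  obtain ⟨F, hF⟩ := hf.exists_eq_hammingWeight
  obtain ⟨ha, hb, hc⟩ := hab
  simp only at ha hb hc
  by_cases h3 : 3 * a ≤ n ∧ 3 * b ≤ n
  · have ca := chooseSum_le_two_mul_choose (m := n) (a := a) (by omega)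
    have cb := chooseSum_le_two_mul_choose (m := n) (a := b) (by omega)
    rcases hc with hc | hc
    · obtain ⟨t, ht, hs⟩ := ParityDecisionTree.exists_eval_eq_of_constant
        (Finset.univ : Finset (Fin n)) F a b (by simpa using hc.eq_of_le hF)
      rw [Finset.card_univ, Fintype.card_fin] at hs
      have := parityTreeSize_le (f := f) (t := t) fun x => (ht x).trans (hF x).symm
      omega
    · obtain ⟨t, ht, hs⟩ := ParityDecisionTree.exists_eval_eq_of_constant
        (Finset.univ : Finset (Fin n)) (fun w => F w * (-1) ^ w) a b
        (by simpa using hc.eq_of_le (G := fun w => F w * (-1) ^ w)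
              fun x => by simp only [hF, parityFun])
      rw [Finset.card_univ, Fintype.card_fin] at hs
      -- `t` computes `f · parity`, so `f` is `t` on even inputs and its negation on odd ones.
      have := parityTreeSize_le (f := f) (t := .node Finset.univ t t.neg) fun x => by
        have hx : t.eval x = f x * parityFun x := by rw [ht, hF, parityFun, weightOn_univ]
        rw [parityFun_eq_ite] at hx
        simp only [ParityDecisionTree.eval, ParityDecisionTree.eval_neg, hx]
        split_ifs <;> simp
      simp only [ParityDecisionTree.size, ParityDecisionTree.size_neg] at this
      omega
  · obtain ⟨t, ht, hs⟩ := ParityDecisionTree.exists_eval_eq_pairs n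
      (Finset.univ : Finset (Fin n)) (by simp) F
    have := parityTreeSize_le (f := f) (t := t) fun x => (ht x).trans (hF x).symm
    rcases not_and_or.mp h3 with h | h
    · have := pairs_size_le_choose (n := n) (r := a) (by omega) ha
      omega
    · have := pairs_size_le_choose (n := n) (r := b) (by omega) hb
      omega

theorem parityTreeSize_le_two {n : ℕ} {f : (Fin n → ZMod 2) → ℤˣ}
    (h : IsAdmissiblePair f (0, 0)) : parityTreeSize f ≤ 2 := by
  rcases h.2.2 with hc | hc
  · have := parityTreeSize_le (f := f) (t := .leaf (f 0)) fun x =>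
      hc _ _ (Nat.zero_le _) (hammingWeight_le _) (Nat.zero_le _) (hammingWeight_le _)
    simp only [ParityDecisionTree.size] at this
    omega
  · have h0 : ∀ x, f x * parityFun x = f 0 * parityFun 0 := fun x =>
      hc x 0 (Nat.zero_le _) (hammingWeight_le _) (Nat.zero_le _) (hammingWeight_le _)
    refine parityTreeSize_le (f := f)
      (t := .node Finset.univ (.leaf (f 0 * parityFun (n := n) 0))
        (.leaf (-(f 0 * parityFun (n := n) 0))))
      fun x => ?_
    simp only [ParityDecisionTree.eval]
    rw [← h0 x, parityFun_eq_ite]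
    split_ifs <;> simp

theorem two_rpow_mul_logb {x : ℝ} (hx : 0 < x) (c r : ℝ) :
    (2 : ℝ) ^ (c * (r * Real.logb 2 x)) = x ^ (c * r) := by
  rw [show c * (r * Real.logb 2 x) = Real.logb 2 x * (c * r) by ring,
    Real.rpow_mul (by norm_num), Real.rpow_logb (by norm_num) (by norm_num) hx]

theorem choose_le_three_mul_div_pow {n r : ℕ} (hr : 1 ≤ r) :
    (n.choose r : ℝ) ≤ (3 * ((n : ℝ) / r)) ^ r := by
  have hr0 : (0 : ℝ) < r := by exact_mod_cast hr
  have hf : (0 : ℝ) < r.factorial := by exact_mod_cast r.factorial_pos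
  have h1 : (r : ℝ) ^ r / r.factorial ≤ 3 ^ r := by
    refine (Real.pow_div_factorial_le_exp (r : ℝ) hr0.le r).trans ?_
    rw [← mul_one (r : ℝ), Real.exp_nat_mul]
    have := Real.exp_one_lt_d9
    exact pow_le_pow_left₀ (Real.exp_pos _).le (by linarith) _
  calc (n.choose r : ℝ) ≤ (n : ℝ) ^ r / r.factorial := Nat.choose_le_pow_div r n
    _ = (r : ℝ) ^ r / r.factorial * ((n : ℝ) / r) ^ r := by
      rw [div_pow]; field_simp
    _ ≤ 3 ^ r * ((n : ℝ) / r) ^ r := by gcongr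
    _ = _ := (mul_pow _ _ _).symm

theorem parityTreeSize_le_rpow {n : ℕ} {f : (Fin n → ZMod 2) → ℤˣ} (hf : IsSymmetricFun f)
    {a b r : ℕ} (hab : IsAdmissiblePair f (a, b)) (hr : r = max a b) (hr1 : 1 ≤ r) :
    (parityTreeSize f : ℝ) ≤
      (2 : ℝ) ^ ((6 : ℝ) * ((r : ℝ) * Real.logb 2 ((n : ℝ) / (r : ℝ)))) := by
  have h2r : 2 * r ≤ n := by
    have h1 := hab.1
    have h2 := hab.2.1
    simp only at h1 h2
    omega
  have hr0 : (0 : ℝ) < r := by exact_mod_cast hr1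
  have hx : (2 : ℝ) ≤ (n : ℝ) / r := by
    rw [le_div_iff₀ hr0]; exact_mod_cast h2r
  rw [two_rpow_mul_logb (by linarith)]
  have h1 : parityTreeSize f ≤ 8 * n.choose r := by
    have h := parityTreeSize_le_choose hf hab
    have ha := choose_le_choose_of_le_half (n := n) (k := a) (l := r) (by omega) h2r
    have hb := choose_le_choose_of_le_half (n := n) (k := b) (l := r) (by omega) h2r
    omega
  have h2 : (parityTreeSize f : ℝ) ≤ 8 * n.choose r := by exact_mod_cast h1
  set x := (n : ℝ) / r
  have h3 : (n.choose r : ℝ) ≤ (3 * x) ^ r := choose_le_three_mul_div_pow hr1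
  have h4 : (x : ℝ) ^ ((6 : ℝ) * r) = (x ^ 6) ^ r := by
    rw [Real.rpow_mul (by linarith), Real.rpow_natCast]
    norm_cast
  -- The exponent `6` comes from `8 * 3 ≤ 2 ^ 5 ≤ x ^ 5`, once the factor `8` is absorbed into the
  -- `r`-th power.
  have h5 : (8 : ℝ) ≤ 8 ^ r := le_self_pow₀ (by norm_num) (by omega)
  calc (parityTreeSize f : ℝ) ≤ 8 ^ r * (3 * x) ^ r := h2.trans (by gcongr)
    _ = (24 * x) ^ r := by rw [← mul_pow]; ring
    _ ≤ (x ^ 6) ^ r := by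
      refine pow_le_pow_left₀ (by linarith) ?_ _
      have : (2 : ℝ) ^ 5 ≤ x ^ 5 := pow_le_pow_left₀ (by norm_num) hx 5
      nlinarith
    _ = _ := h4.symm

/-! ### Affine subspaces: the lower bound when `r` is small compared to `n` -/

/-- A set of points of the cube that is closed under sums of three of its elements: an affine
subspace, or the empty set. -/
def TripleClosed {n : ℕ} (A : Finset (Fin n → ZMod 2)) : Prop :=
  ∀ x ∈ A, ∀ y ∈ A, ∀ z ∈ A, x + y + z ∈ A

theorem TripleClosed.filter_sum_eq {n : ℕ} {A : Finset (Fin n → ZMod 2)} (hA : TripleClosed A)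
    (S : Finset (Fin n)) (c : ZMod 2) :
    TripleClosed (A.filter fun x => ∑ i ∈ S, x i = c) := by
  intro x hx y hy z hz
  simp only [Finset.mem_filter] at hx hy hz ⊢
  refine ⟨hA x hx.1 y hy.1 z hz.1, ?_⟩
  simp only [Pi.add_apply, Finset.sum_add_distrib, hx.2, hy.2, hz.2]
  rw [CharTwo.add_self_eq_zero, zero_add]

namespace ParityDecisionTree

/-- If every affine subspace on which a tree is constant has measure at most `M`, then the
tree has at least `μ(B) / M` leaves. -/
theorem card_inter_le_size_mul {n : ℕ} (E : Finset (Fin n → ZMod 2)) (M : ℕ)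
    (t : ParityDecisionTree n) : ∀ B : Finset (Fin n → ZMod 2), TripleClosed B →
      (∀ A ⊆ B, TripleClosed A → (∀ x ∈ A, ∀ y ∈ A, t.eval x = t.eval y) →
        (A ∩ E).card ≤ M) →
      (B ∩ E).card ≤ t.size * M := by
  induction t with
  | leaf v =>
    intro B hB h
    simpa [size] using h B subset_rfl hB fun x _ y _ => rfl
  | node S t₀ t₁ ih₀ ih₁ =>
    intro B hB h
    have h₀ := ih₀ _ (hB.filter_sum_eq S 0) fun A hA hA' hc =>
      h A (hA.trans (Finset.filter_subset _ _)) hA' fun x hx y hy => by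
        simp only [eval, (Finset.mem_filter.mp (hA hx)).2, (Finset.mem_filter.mp (hA hy)).2,
          if_true, hc x hx y hy]
    have h₁ := ih₁ _ (hB.filter_sum_eq S 1) fun A hA hA' hc =>
      h A (hA.trans (Finset.filter_subset _ _)) hA' fun x hx y hy => by
        simp only [eval, (Finset.mem_filter.mp (hA hx)).2, (Finset.mem_filter.mp (hA hy)).2,
          one_ne_zero, if_false, hc x hx y hy]
    have hu : B ∩ E ⊆ (B.filter fun x => ∑ i ∈ S, x i = 0) ∩ E ∪
        (B.filter fun x => ∑ i ∈ S, x i = 1) ∩ E := by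
      intro x hx
      simp only [Finset.mem_union, Finset.mem_inter, Finset.mem_filter] at hx ⊢
      by_cases h0 : ∑ i ∈ S, x i = 0
      · exact Or.inl ⟨⟨hx.1, h0⟩, hx.2⟩
      · exact Or.inr ⟨⟨hx.1, ZMod.two_eq_one_of_ne_zero h0⟩, hx.2⟩
    have := (Finset.card_le_card hu).trans (Finset.card_union_le _ _)
    simp only [size, add_mul]
    omega

end ParityDecisionTree

/-- If some `y` in `B` has the other parity on `S`, then `z ↦ z + y + p` injects the points of that
parity into the fibre of `p`. -/
theorem TripleClosed.card_le_two_mul {n : ℕ} {B : Finset (Fin n → ZMod 2)}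
    (hB : TripleClosed B) (S : Finset (Fin n)) {p : Fin n → ZMod 2} (hp : p ∈ B) :
    B.card ≤ 2 * (B.filter fun x => ∑ i ∈ S, x i = ∑ i ∈ S, p i).card := by
  classical
  have hsplit := Finset.card_filter_add_card_filter_not (s := B)
    (fun x => ∑ i ∈ S, x i = ∑ i ∈ S, p i)
  suffices h : (B.filter fun x => ¬ ∑ i ∈ S, x i = ∑ i ∈ S, p i).card ≤
      (B.filter fun x => ∑ i ∈ S, x i = ∑ i ∈ S, p i).card by omega
  by_cases hy : ∃ y ∈ B, ¬ ∑ i ∈ S, y i = ∑ i ∈ S, p i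
  · obtain ⟨y, hyB, hy⟩ := hy
    refine Finset.card_le_card_of_injOn (fun z => z + y + p) ?_ ?_
    · intro z hz
      simp only [Finset.coe_filter, Set.mem_ofPred_eq] at hz ⊢
      refine ⟨hB z hz.1 y hyB p hp, ?_⟩
      simp only [Pi.add_apply, Finset.sum_add_distrib]
      have key : ∀ a b c : ZMod 2, a ≠ c → b ≠ c → a + b + c = c := by decide
      exact key _ _ _ hz.2 hy
    · intro z _ w _ h
      simpa using h
  · push Not at hy
    rw [Finset.filter_false_of_mem fun x hx => not_not.mpr (hy x hx)]
    simp

namespace ParityDecisionTree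

/-- If the affine subspaces through `p` on which a tree is constant are small, then the tree
has a long path. -/
theorem card_le_mul_two_pow_size {n : ℕ} {p : Fin n → ZMod 2} (M : ℕ)
    (t : ParityDecisionTree n) : ∀ B : Finset (Fin n → ZMod 2), TripleClosed B → p ∈ B →
      (∀ A ⊆ B, TripleClosed A → p ∈ A → (∀ x ∈ A, ∀ y ∈ A, t.eval x = t.eval y) →
        A.card ≤ M) →
      B.card ≤ M * 2 ^ t.size := by
  induction t with
  | leaf v =>
    intro B hB hp h
    have := h B subset_rfl hB hp fun x _ y _ => rfl
    simp only [size, pow_one]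
    omega
  | node S t₀ t₁ ih₀ ih₁ =>
    intro B hB hp h
    have h2 := hB.card_le_two_mul S hp
    have hpB : p ∈ B.filter fun x => ∑ i ∈ S, x i = ∑ i ∈ S, p i :=
      Finset.mem_filter.mpr ⟨hp, rfl⟩
    have hcl := hB.filter_sum_eq S (∑ i ∈ S, p i)
    have hs₀ := t₀.one_le_size
    have hs₁ := t₁.one_le_size
    simp only [size]
    by_cases h0 : ∑ i ∈ S, p i = 0
    · have := ih₀ _ hcl hpB fun A hA hA' hpA hc =>
        h A (hA.trans (Finset.filter_subset _ _)) hA' hpA fun x hx y hy => by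
          simp only [eval, (Finset.mem_filter.mp (hA hx)).2, (Finset.mem_filter.mp (hA hy)).2,
            h0, if_true, hc x hx y hy]
      calc B.card ≤ 2 * (M * 2 ^ t₀.size) := h2.trans (Nat.mul_le_mul_left _ this)
        _ = M * 2 ^ (t₀.size + 1) := by ring
        _ ≤ _ := Nat.mul_le_mul_left _ (Nat.pow_le_pow_right (by norm_num) (by omega))
    · have := ih₁ _ hcl hpB fun A hA hA' hpA hc =>
        h A (hA.trans (Finset.filter_subset _ _)) hA' hpA fun x hx y hy => by
          simp only [eval, (Finset.mem_filter.mp (hA hx)).2, (Finset.mem_filter.mp (hA hy)).2,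
            h0, if_false, hc x hx y hy]
      calc B.card ≤ 2 * (M * 2 ^ t₁.size) := h2.trans (Nat.mul_le_mul_left _ this)
        _ = M * 2 ^ (t₁.size + 1) := by ring
        _ ≤ _ := Nat.mul_le_mul_left _ (Nat.pow_le_pow_right (by norm_num) (by omega))

end ParityDecisionTree

/-- An affine subspace all of whose points have weight at most `k` has dimension at most
`2 * k`: each of the coordinates that vary equals `1` on half of the points. -/
theorem TripleClosed.card_le_four_pow {n k : ℕ} {A : Finset (Fin n → ZMod 2)}
    (hA : TripleClosed A) (hk : ∀ x ∈ A, hammingWeight x ≤ k) : A.card ≤ 4 ^ k := by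
  classical
  rcases A.eq_empty_or_nonempty with rfl | ⟨p, hp⟩
  · simp
  set V : Finset (Fin n) := Finset.univ.filter fun i => ∃ x ∈ A, x i ≠ p i with hV
  have hinj : A.card ≤ 2 ^ V.card := by
    have h1 : A.card ≤ (Finset.univ : Finset (V → ZMod 2)).card := by
      refine Finset.card_le_card_of_injOn (fun x i => x i) (by simp) fun x hx y hy hxy => ?_
      funext i
      by_cases hi : i ∈ V
      · exact congrFun hxy ⟨i, hi⟩
      · simp only [hV, Finset.mem_filter, Finset.mem_univ, true_and, not_exists, not_and,
          not_not] at hi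
        rw [hi x hx, hi y hy]
    simpa using h1
  have hhalf : ∀ i ∈ V, A.card ≤ 2 * (A.filter fun x => x i = 1).card := by
    intro i hi
    obtain ⟨x, hx, hxp⟩ := (Finset.mem_filter.mp hi).2
    obtain ⟨q, hq, hq1⟩ : ∃ q ∈ A, q i = 1 := by
      by_cases h : p i = 0
      · exact ⟨x, hx, ZMod.two_eq_one_of_ne_zero (h ▸ hxp)⟩
      · exact ⟨p, hp, ZMod.two_eq_one_of_ne_zero h⟩
    simpa [hq1] using hA.card_le_two_mul {i} hq
  have hcount : V.card * A.card ≤ 2 * (k * A.card) := by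
    calc V.card * A.card = ∑ i ∈ V, A.card := by simp
      _ ≤ ∑ i ∈ V, 2 * (A.filter fun x => x i = 1).card := Finset.sum_le_sum hhalf
      _ ≤ ∑ i, 2 * (A.filter fun x => x i = 1).card :=
        Finset.sum_le_sum_of_subset (Finset.subset_univ _)
      _ = 2 * ∑ x ∈ A, hammingWeight x := by
        simp only [hammingWeight, Finset.card_filter, ← Finset.mul_sum]
        rw [Finset.sum_comm]
      _ ≤ 2 * (k * A.card) := by
        refine Nat.mul_le_mul_left _ ((Finset.sum_le_sum hk).trans ?_)
        simp [mul_comm]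
  have hV2 : V.card ≤ 2 * k := by
    refine Nat.le_of_mul_le_mul_right (c := A.card) ?_ (Finset.card_pos.mpr ⟨p, hp⟩)
    rwa [mul_assoc]
  calc A.card ≤ 2 ^ V.card := hinj
    _ ≤ 2 ^ (2 * k) := Nat.pow_le_pow_right (by norm_num) hV2
    _ = 4 ^ k := by rw [pow_mul]; norm_num

theorem hammingWeight_add_le {n : ℕ} (x y : Fin n → ZMod 2) :
    hammingWeight (x + y) ≤ hammingWeight x + hammingWeight y := by
  classical
  refine (Finset.card_le_card ?_).trans (Finset.card_union_le _ _)
  intro i hi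
  simp only [Finset.mem_union, Finset.mem_filter, Finset.mem_univ, true_and, Pi.add_apply]
    at hi ⊢
  have : ∀ a b : ZMod 2, a + b = 1 → a = 1 ∨ b = 1 := by decide
  exact this _ _ hi

theorem natCast_hammingWeight {n : ℕ} (x : Fin n → ZMod 2) :
    (hammingWeight x : ZMod 2) = ∑ i, x i := by
  rw [sum_eq_natCast_weightOn, weightOn_univ]

theorem tripleClosed_univ {n : ℕ} :
    TripleClosed (Finset.univ : Finset (Fin n → ZMod 2)) := fun _ _ _ _ _ _ => Finset.mem_univ _

theorem mod_two_eq_of_mem_filter_sum {n w : ℕ} {x : Fin n → ZMod 2}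
    (hx : ∑ i, x i = (w : ZMod 2)) : hammingWeight x % 2 = w % 2 := by
  rw [← natCast_hammingWeight] at hx
  exact (ZMod.natCast_eq_natCast_iff' _ _ _).mp hx

/-- Lower bound for the size of a tree that separates the layer `k` from the layers of the same
parity in a window that is large compared to `k`. -/
theorem choose_le_size_mul_four_pow {n k b : ℕ} {F : ℕ → ℤˣ} {t : ParityDecisionTree n}
    (ht : ∀ x, t.eval x = F (hammingWeight x)) (hkb : 3 * k + b ≤ n)
    (hF : ∀ w, k + 2 ≤ w → w + b ≤ n → w % 2 = k % 2 → F w ≠ F k) :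
    n.choose k ≤ t.size * 4 ^ k := by
  classical
  set E : Finset (Fin n → ZMod 2) := Finset.univ.filter fun x => hammingWeight x = k with hE
  set B : Finset (Fin n → ZMod 2) :=
    Finset.univ.filter fun x => ∑ i, x i = (k : ZMod 2) with hBdef
  have hB : TripleClosed B := tripleClosed_univ.filter_sum_eq _ _
  have hmain := t.card_inter_le_size_mul E (4 ^ k) B hB fun A hAB hA hc => by
    rcases (A ∩ E).eq_empty_or_nonempty with he | ⟨p, hp⟩
    · simp [he]
    obtain ⟨hpA, hpE⟩ := Finset.mem_inter.mp hp
    have hpk : hammingWeight p = k := (Finset.mem_filter.mp hpE).2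
    have hw : ∀ x ∈ A, hammingWeight x ≤ k ∨ n < hammingWeight x + b := by
      intro x hx
      by_contra! h
      have hpar := mod_two_eq_of_mem_filter_sum (Finset.mem_filter.mp (hAB hx)).2
      refine hF (hammingWeight x) (by omega) h.2 hpar ?_
      rw [← ht, hc x hx p hpA, ht, hpk]
    -- A sum of three points of weight at most `k` has weight at most `3 * k ≤ n - b`, so of the two
    -- ranges in `hw` it must lie in the lower one.
    have hA' : TripleClosed (A.filter fun x => hammingWeight x ≤ k) := by
      intro x hx y hy z hz
      rw [Finset.mem_filter] at hx hy hz ⊢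
      have hmem := hA x hx.1 y hy.1 z hz.1
      refine ⟨hmem, (hw _ hmem).resolve_right ?_⟩
      have h1 := hammingWeight_add_le (x + y) z
      have h2 := hammingWeight_add_le x y
      omega
    refine (Finset.card_le_card fun x hx => ?_).trans
      (hA'.card_le_four_pow fun x hx => (Finset.mem_filter.mp hx).2)
    obtain ⟨hxA, hxE⟩ := Finset.mem_inter.mp hx
    exact Finset.mem_filter.mpr ⟨hxA, (Finset.mem_filter.mp hxE).2.le⟩
  refine le_trans ?_ hmain
  have hcard : (Finset.powersetCard k (Finset.univ : Finset (Fin n))).card = n.choose k := by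
    simp
  rw [← hcard]
  refine Finset.card_le_card_of_injOn cubePoint ?_ ?_
  · intro U hU
    have hU : U.card = k := (Finset.mem_powersetCard.mp hU).2
    simp only [hE, hBdef, Finset.coe_inter, Finset.coe_filter, Finset.mem_univ, true_and,
      Set.mem_inter_iff, Set.mem_ofPred_eq, ← natCast_hammingWeight, hammingWeight_cubePoint, hU]
  · intro U _ V _ h
    ext i
    have := congrFun h i
    by_cases h1 : i ∈ U <;> by_cases h2 : i ∈ V <;> simp_all [cubePoint]

/-- This is the case `k = 0`, in which counting points of layer `k` gives only one leaf. Among the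
even points that share a leaf with `0` there are only `0` and possibly the all-ones point. Each
query on the path of `0` at most halves the subspace, so the path, and with it the tree, is large.
-/
theorem le_size_add_two_of_isolated {n : ℕ} {F : ℕ → ℤˣ} {t : ParityDecisionTree n}
    (ht : ∀ x, t.eval x = F (hammingWeight x))
    (hF : ∀ w, 2 ≤ w → w + 1 ≤ n → w % 2 = 0 → F w ≠ F 0) : n ≤ t.size + 2 := by
  classical
  have h0 : hammingWeight (0 : Fin n → ZMod 2) = 0 := by simp [hammingWeight]
  have hB : TripleClosed (Finset.univ.filter fun x : Fin n → ZMod 2 => ∑ i, x i = 0) :=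
    tripleClosed_univ.filter_sum_eq _ _
  have hmain := t.card_le_mul_two_pow_size (p := 0) 2 _ hB (by simp) fun A hAB hA hpA hc => by
    have hsub : A ⊆ {0, 1} := by
      intro x hx
      have hpar := mod_two_eq_of_mem_filter_sum (w := 0)
        (by simpa using (Finset.mem_filter.mp (hAB hx)).2)
      have hw : hammingWeight x = 0 ∨ hammingWeight x = n := by
        by_contra! h
        have hle := hammingWeight_le x
        refine hF (hammingWeight x) (by omega) (by omega) (by omega) ?_
        rw [← ht, hc x hx 0 hpA, ht, h0]
      simp only [Finset.mem_insert, Finset.mem_singleton]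
      rcases hw with hw | hw
      · left
        funext i
        by_contra hi
        have : i ∈ Finset.univ.filter fun i => x i = 1 := by
          simpa using ZMod.two_eq_one_of_ne_zero hi
        rw [Finset.card_eq_zero.mp hw] at this
        simp at this
      · right
        funext i
        have : (Finset.univ.filter fun i => x i = 1) = Finset.univ :=
          Finset.eq_univ_of_card _ (by simpa [hammingWeight] using hw)
        have hi := Finset.mem_univ i
        rw [← this] at hi
        exact (Finset.mem_filter.mp hi).2
    exact (Finset.card_le_card hsub).trans Finset.card_le_two
  have hhalf := tripleClosed_univ.card_le_two_mul Finset.univ (p := (0 : Fin n → ZMod 2))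
    (Finset.mem_univ _)
  simp only [Pi.zero_apply, Finset.sum_const_zero] at hhalf
  have h2 : 2 ^ n ≤ 2 ^ (t.size + 2) := by
    have : (Finset.univ : Finset (Fin n → ZMod 2)).card = 2 ^ n := by simp
    rw [this] at hhalf
    calc 2 ^ n ≤ 2 * (2 * 2 ^ t.size) := hhalf.trans (Nat.mul_le_mul_left _ hmain)
      _ = _ := by ring
  exact (Nat.pow_le_pow_iff_right (by norm_num)).mp h2

/-! ### Fourier analysis of trees and of layers -/

/-- The character `U ↦ (-1)^|S ∩ U|` of the cube of subsets. -/
def walsh {n : ℕ} (S U : Finset (Fin n)) : ℝ := (-1) ^ (S ∩ U).card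

theorem walsh_comm {n : ℕ} (S U : Finset (Fin n)) : walsh S U = walsh U S := by
  rw [walsh, walsh, Finset.inter_comm]

theorem walsh_eq_prod {n : ℕ} (S U : Finset (Fin n)) :
    walsh S U = ∏ i ∈ U, if i ∈ S then (-1 : ℝ) else 1 := by
  rw [Finset.prod_ite, Finset.prod_const, Finset.prod_const_one, mul_one,
    Finset.filter_mem_eq_inter, Finset.inter_comm, walsh]

theorem walsh_mul {n : ℕ} (S T U : Finset (Fin n)) :
    walsh S U * walsh T U = walsh (symmDiff S T) U := by
  rw [walsh_eq_prod, walsh_eq_prod, walsh_eq_prod, ← Finset.prod_mul_distrib]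
  refine Finset.prod_congr rfl fun i _ => ?_
  by_cases h1 : i ∈ S <;> by_cases h2 : i ∈ T <;> simp [Finset.mem_symmDiff, h1, h2]

theorem walsh_compl {n : ℕ} (T U : Finset (Fin n)) :
    walsh T U = (-1) ^ U.card * walsh Tᶜ U := by
  rw [walsh_eq_prod, walsh_eq_prod, ← Finset.prod_const, ← Finset.prod_mul_distrib]
  refine Finset.prod_congr rfl fun i _ => ?_
  by_cases h1 : i ∈ T <;> simp [h1]

theorem sum_walsh {n : ℕ} (S : Finset (Fin n)) :
    ∑ T, walsh S T = if S = ∅ then (2 : ℝ) ^ n else 0 := by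
  simp only [walsh_eq_prod]
  rw [← Finset.powerset_univ, ← Finset.prod_one_add]
  split_ifs with h
  · subst h
    norm_num
  · obtain ⟨i, hi⟩ := Finset.nonempty_iff_ne_empty.mpr h
    exact Finset.prod_eq_zero (Finset.mem_univ i) (by simp [hi])

theorem sum_cubePoint_eq_zero_iff {n : ℕ} (S U : Finset (Fin n)) :
    ∑ i ∈ S, cubePoint U i = 0 ↔ walsh S U = 1 := by
  rw [sum_eq_natCast_weightOn, weightOn_cubePoint, ZMod.natCast_eq_zero_iff_even, walsh,
    neg_one_pow_eq_one_iff_even (by norm_num)]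

theorem walsh_eq_one_or {n : ℕ} (S U : Finset (Fin n)) : walsh S U = 1 ∨ walsh S U = -1 :=
  neg_one_pow_eq_or ℝ _

/-- A function whose Fourier coefficients are at most `M` has correlation at most `size * M`
with a parity decision tree. -/
theorem ParityDecisionTree.abs_sum_mul_eval_le {n : ℕ} {g : Finset (Fin n) → ℝ} {M : ℝ}
    (hg : ∀ T, |∑ U, g U * walsh T U| ≤ M) (t : ParityDecisionTree n) :
    ∀ T, |∑ U, g U * walsh T U * ((t.eval (cubePoint U) : ℤ) : ℝ)| ≤ t.size * M := by
  induction t with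
  | leaf v =>
    intro T
    simp only [eval, size, Nat.cast_one, one_mul]
    rw [← Finset.sum_mul, abs_mul]
    rcases Int.units_eq_one_or v with rfl | rfl <;> simpa using hg T
  | node S t₀ t₁ ih₀ ih₁ =>
    intro T
    -- The indicators of the two branches are `(1 ± walsh S U) / 2`, and multiplying by `walsh S`
    -- only shifts the frequency `T`.
    have h : ∑ U, g U * walsh T U * (((node S t₀ t₁).eval (cubePoint U) : ℤ) : ℝ) =
        (∑ U, g U * walsh T U * ((t₀.eval (cubePoint U) : ℤ) : ℝ) +
         ∑ U, g U * walsh (symmDiff T S) U * ((t₀.eval (cubePoint U) : ℤ) : ℝ) +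
         ∑ U, g U * walsh T U * ((t₁.eval (cubePoint U) : ℤ) : ℝ) -
         ∑ U, g U * walsh (symmDiff T S) U * ((t₁.eval (cubePoint U) : ℤ) : ℝ)) / 2 := by
      rw [← Finset.sum_add_distrib, ← Finset.sum_add_distrib, ← Finset.sum_sub_distrib,
        Finset.sum_div]
      refine Finset.sum_congr rfl fun U _ => ?_
      simp only [eval, sum_cubePoint_eq_zero_iff, ← walsh_mul]
      rcases walsh_eq_one_or S U with h | h
      · simp only [h, if_true]; ring
      · simp only [h, show ¬ ((-1 : ℝ) = 1) by norm_num, if_false]; ring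
    rw [h]
    have a1 := abs_le.mp (ih₀ T)
    have a2 := abs_le.mp (ih₀ (symmDiff T S))
    have a3 := abs_le.mp (ih₁ T)
    have a4 := abs_le.mp (ih₁ (symmDiff T S))
    simp only [size, Nat.cast_add, add_mul]
    rw [abs_le]
    constructor <;> linarith [a1.1, a1.2, a2.1, a2.2, a3.1, a3.2, a4.1, a4.2]

/-- The Fourier coefficient at `T` of the layer of weight `w`, a value of a Krawtchouk
polynomial. -/
def krawtchouk {n : ℕ} (w : ℕ) (T : Finset (Fin n)) : ℝ :=
  ∑ U ∈ Finset.powersetCard w Finset.univ, walsh T U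

/-- A random `w`-set contains `V` with probability `w.choose V.card / n.choose V.card`, a polynomial
in `w` of degree `V.card`; the statement is cleared of denominators. -/
theorem card_filter_subset_powersetCard {n : ℕ} (w : ℕ) (V : Finset (Fin n)) :
    ((Finset.powersetCard w Finset.univ).filter fun U => V ⊆ U).card * n.choose V.card =
      n.choose w * w.choose V.card := by
  rcases lt_or_ge w V.card with h | h
  · rw [Nat.choose_eq_zero_of_lt h, mul_zero, Finset.filter_false_of_mem, Finset.card_empty,
      zero_mul]
    intro U hU hV
    have := Finset.card_le_card hV
    rw [(Finset.mem_powersetCard.mp hU).2] at this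
    omega
  · have himg : ((Finset.powersetCard w Finset.univ).filter fun U => V ⊆ U) =
        (Finset.powersetCard (w - V.card) Vᶜ).image fun U => V ∪ U := by
      ext U
      simp only [Finset.mem_filter, Finset.mem_powersetCard, Finset.subset_univ, true_and,
        Finset.mem_image]
      constructor
      · rintro ⟨hw, hV⟩
        refine ⟨U \ V, ⟨?_, ?_⟩, Finset.union_sdiff_of_subset hV⟩
        · intro i hi
          simp only [Finset.mem_sdiff] at hi
          simpa using hi.2
        · rw [Finset.card_sdiff_of_subset hV, hw]
      · rintro ⟨U', ⟨hd, hc⟩, rfl⟩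
        refine ⟨?_, Finset.subset_union_left⟩
        rw [Finset.card_union_of_disjoint, hc]
        · omega
        · exact (Finset.disjoint_left.mpr fun i hi hi' => by
            simpa [hi] using hd hi')
    have hinj : Set.InjOn (fun U => V ∪ U) (Finset.powersetCard (w - V.card) Vᶜ :
        Finset (Finset (Fin n))) := by
      intro U₁ h₁ U₂ h₂ he
      have h₁ := (Finset.mem_powersetCard.mp h₁).1
      have h₂ := (Finset.mem_powersetCard.mp h₂).1
      ext i
      have hi : i ∈ V ∪ U₁ ↔ i ∈ V ∪ U₂ := by
        simp only at he
        rw [he]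
      simp only [Finset.mem_union] at hi
      by_cases hV : i ∈ V
      · have a1 : i ∉ U₁ := fun h => by simpa [hV] using h₁ h
        have a2 : i ∉ U₂ := fun h => by simpa [hV] using h₂ h
        simp [a1, a2]
      · simpa [hV] using hi
    rw [himg, Finset.card_image_of_injOn hinj, Finset.card_powersetCard, Finset.card_compl,
      Fintype.card_fin]
    rcases le_or_gt w n with hw | hw
    · rw [Nat.choose_mul h, mul_comm]
    · rw [Nat.choose_eq_zero_of_lt hw, zero_mul]
      have hV : V.card ≤ n := by simpa using Finset.card_le_univ V
      rw [Nat.choose_eq_zero_of_lt (by omega), zero_mul]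

/-- Each factor of the product is `1 - 2 * [i ∈ U]`; expand. -/
theorem walsh_eq_sum_powerset {n : ℕ} (T U : Finset (Fin n)) :
    walsh T U = ∑ V ∈ T.powerset, if V ⊆ U then (-2 : ℝ) ^ V.card else 0 := by
  rw [walsh_comm, walsh_eq_prod]
  have : ∀ i ∈ T, (if i ∈ U then (-1 : ℝ) else 1) = 1 + if i ∈ U then (-2 : ℝ) else 0 := by
    intro i _
    split_ifs <;> norm_num
  rw [Finset.prod_congr rfl this, Finset.prod_one_add]
  refine Finset.sum_congr rfl fun V _ => ?_
  split_ifs with h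
  · rw [Finset.prod_congr rfl fun i hi => if_pos (h hi), Finset.prod_const]
  · obtain ⟨i, hi, hiU⟩ := Finset.not_subset.mp h
    exact Finset.prod_eq_zero hi (if_neg hiU)

/-- Divided by `n.choose w`, the coefficient is a polynomial in `w` of degree at most `T.card`. A
combination of layers that annihilates low degrees therefore has no low frequencies. -/
theorem krawtchouk_eq {n : ℕ} (w : ℕ) (T : Finset (Fin n)) :
    krawtchouk w T = n.choose w * ∑ v ∈ Finset.range (T.card + 1),
      (T.card.choose v * (-2 : ℝ) ^ v / n.choose v) * w.choose v := by
  have h := Finset.sum_powerset_apply_card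
    (fun v => (-2 : ℝ) ^ v / n.choose v * w.choose v * n.choose w) (x := T)
  simp only [nsmul_eq_mul] at h
  calc krawtchouk w T = ∑ V ∈ T.powerset, ∑ U ∈ Finset.powersetCard w Finset.univ,
        (if V ⊆ U then (-2 : ℝ) ^ V.card else 0) := by
        rw [Finset.sum_comm]
        exact Finset.sum_congr rfl fun U _ => walsh_eq_sum_powerset T U
    _ = ∑ V ∈ T.powerset, (-2 : ℝ) ^ V.card / n.choose V.card * w.choose V.card *
          n.choose w := by
        refine Finset.sum_congr rfl fun V _ => ?_
        have h1 := card_filter_subset_powersetCard w V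
        have hV : V.card ≤ n := by simpa using Finset.card_le_univ V
        have h0 : (0 : ℝ) < n.choose V.card := by exact_mod_cast Nat.choose_pos hV
        rw [← Finset.sum_filter, Finset.sum_const, nsmul_eq_mul]
        have h2 : (((Finset.powersetCard w Finset.univ).filter fun U => V ⊆ U).card : ℝ) *
            n.choose V.card = n.choose w * w.choose V.card := by exact_mod_cast h1
        field_simp
        linear_combination h2
    _ = _ := by
        rw [h, Finset.mul_sum]
        exact Finset.sum_congr rfl fun v _ => by ring

theorem krawtchouk_eq_of_card_eq {n : ℕ} (w : ℕ) {S T : Finset (Fin n)} (h : S.card = T.card) :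
    krawtchouk w S = krawtchouk w T := by
  rw [krawtchouk_eq, krawtchouk_eq, h]

theorem sum_krawtchouk_sq {n : ℕ} (w : ℕ) :
    ∑ T : Finset (Fin n), krawtchouk w T ^ 2 = 2 ^ n * n.choose w := by
  simp only [krawtchouk, sq, Finset.sum_mul_sum]
  rw [Finset.sum_comm]
  have : ∀ U ∈ Finset.powersetCard w (Finset.univ : Finset (Fin n)),
      ∑ T, ∑ V ∈ Finset.powersetCard w Finset.univ, walsh T U * walsh T V = 2 ^ n := by
    intro U hU
    rw [Finset.sum_comm]
    have h1 : ∀ V, ∑ T, walsh T U * walsh T V = if U = V then (2 : ℝ) ^ n else 0 := by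
      intro V
      simp only [walsh_comm _ U, walsh_comm _ V, walsh_mul, sum_walsh]
      simp only [← Finset.bot_eq_empty, symmDiff_eq_bot]
    simp only [h1, Finset.sum_ite_eq, hU, if_true]
  rw [Finset.sum_congr rfl this]
  simp [mul_comm]

/-- All `n.choose T.card` sets of the size of `T` contribute equally to the Parseval sum
`sum_krawtchouk_sq`. -/
theorem choose_mul_krawtchouk_sq_le {n : ℕ} (w : ℕ) (T : Finset (Fin n)) :
    n.choose T.card * krawtchouk w T ^ 2 ≤ 2 ^ n * n.choose w := by
  rw [← sum_krawtchouk_sq]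
  calc (n.choose T.card : ℝ) * krawtchouk w T ^ 2
      = ∑ S ∈ Finset.powersetCard T.card (Finset.univ : Finset (Fin n)),
          krawtchouk w S ^ 2 := by
        rw [Finset.sum_congr rfl fun S hS => by
          rw [krawtchouk_eq_of_card_eq w (Finset.mem_powersetCard.mp hS).2], Finset.sum_const]
        simp
    _ ≤ _ := Finset.sum_le_sum_of_subset_of_nonneg (Finset.subset_univ _)
        fun _ _ _ => sq_nonneg _

theorem sum_card_eq_sum_range {n : ℕ} (c : ℕ → ℝ) (h : Finset (Fin n) → ℝ) :
    ∑ U, c U.card * h U = ∑ w ∈ Finset.range (n + 1),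
      c w * ∑ U ∈ Finset.powersetCard w Finset.univ, h U := by
  rw [← Finset.sum_fiberwise_of_maps_to (s := Finset.univ) (t := Finset.range (n + 1))
    (g := Finset.card)]
  · refine Finset.sum_congr rfl fun w _ => ?_
    rw [Finset.mul_sum, Finset.powersetCard_eq_filter, Finset.powerset_univ]
    refine Finset.sum_congr rfl fun U hU => ?_
    rw [(Finset.mem_filter.mp hU).2]
  · intro U _
    have : U.card ≤ n := by simpa using Finset.card_le_univ U
    simpa [Nat.lt_succ_iff] using this

/-- The Fourier coefficients of a signed combination of layers that annihilates polynomials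
of degree at most `D` in the weight, and is supported on weights of one parity. -/
theorem abs_sum_layers_mul_walsh_le {n D p : ℕ} {c : ℕ → ℝ} {β : ℝ} (hβ : 0 ≤ β)
    (hann : ∀ v ≤ D, ∑ w ∈ Finset.range (n + 1), c w * w.choose v = 0)
    (hpar : ∀ w, c w ≠ 0 → w % 2 = p)
    (hmid : ∀ w j, c w ≠ 0 → w ≤ n → D < j → j + D < n →
      (2 : ℝ) ^ n ≤ β ^ 2 * (n.choose w * n.choose j))
    (T : Finset (Fin n)) :
    |∑ U, c U.card / n.choose U.card * walsh T U| ≤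
      β * ∑ w ∈ Finset.range (n + 1), |c w| := by
  have hsum : 0 ≤ ∑ w ∈ Finset.range (n + 1), |c w| :=
    Finset.sum_nonneg fun _ _ => abs_nonneg _
  have hform : ∀ T : Finset (Fin n), ∑ U, c U.card / n.choose U.card * walsh T U =
      ∑ w ∈ Finset.range (n + 1), c w / n.choose w * krawtchouk w T := fun T =>
    sum_card_eq_sum_range (fun w => c w / n.choose w) (walsh T)
  have hlow : ∀ T : Finset (Fin n), T.card ≤ D →
      ∑ U, c U.card / n.choose U.card * walsh T U = 0 := by
    intro T hT
    rw [hform]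
    calc _ = ∑ w ∈ Finset.range (n + 1), ∑ v ∈ Finset.range (T.card + 1),
          (T.card.choose v * (-2 : ℝ) ^ v / n.choose v) * (c w * w.choose v) := by
          refine Finset.sum_congr rfl fun w hw => ?_
          have h0 : (n.choose w : ℝ) ≠ 0 := by
            have : w ≤ n := by simpa [Nat.lt_succ_iff] using hw
            exact_mod_cast (Nat.choose_pos this).ne'
          rw [krawtchouk_eq, ← mul_assoc, div_mul_cancel₀ _ h0, Finset.mul_sum]
          exact Finset.sum_congr rfl fun v _ => by ring
      _ = 0 := by
          rw [Finset.sum_comm]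
          refine Finset.sum_eq_zero fun v hv => ?_
          rw [← Finset.mul_sum, hann v, mul_zero]
          have := Finset.mem_range.mp hv
          omega
  by_cases h1 : T.card ≤ D
  · rw [hlow T h1, abs_zero]
    positivity
  -- On layers of parity `p` the characters of `T` and of `Tᶜ` differ by the sign `(-1) ^ p`, so
  -- high frequencies reduce to low ones.
  by_cases h2 : n ≤ T.card + D
  · have : ∑ U, c U.card / n.choose U.card * walsh T U =
        (-1) ^ p * ∑ U, c U.card / n.choose U.card * walsh Tᶜ U := by
      rw [Finset.mul_sum]
      refine Finset.sum_congr rfl fun U _ => ?_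
      rw [walsh_compl]
      by_cases h0 : c U.card = 0
      · simp [h0]
      · rw [neg_one_pow_eq_pow_mod_two, hpar _ h0]
        ring
    rw [this, hlow, mul_zero, abs_zero]
    · positivity
    · rw [Finset.card_compl, Fintype.card_fin]
      omega
  rw [hform, Finset.mul_sum]
  refine (Finset.abs_sum_le_sum_abs _ _).trans (Finset.sum_le_sum fun w hw => ?_)
  have hwn : w ≤ n := by simpa [Nat.lt_succ_iff] using hw
  by_cases h0 : c w = 0
  · simp [h0]
  have hw0 : (0 : ℝ) < n.choose w := by exact_mod_cast Nat.choose_pos hwn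
  have hT : T.card ≤ n := by simpa using Finset.card_le_univ T
  have hT0 : (0 : ℝ) < n.choose T.card := by exact_mod_cast Nat.choose_pos hT
  have hK : |krawtchouk w T| ≤ β * n.choose w := by
    refine abs_le_of_sq_le_sq ?_ (by positivity)
    refine le_of_mul_le_mul_left ?_ hT0
    calc (n.choose T.card : ℝ) * krawtchouk w T ^ 2 ≤ 2 ^ n * n.choose w :=
          choose_mul_krawtchouk_sq_le w T
      _ ≤ β ^ 2 * (n.choose w * n.choose T.card) * n.choose w := by
          gcongr
          exact hmid w _ h0 hwn (by omega) (by omega)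
      _ = _ := by ring
  rw [abs_mul, abs_div, abs_of_pos hw0, div_mul_eq_mul_div, div_le_iff₀ hw0]
  calc |c w| * |krawtchouk w T| ≤ |c w| * (β * n.choose w) := by gcongr
    _ = _ := by ring

/-- Lower bound for the size of a tree that computes a symmetric function. -/
theorem abs_sum_layers_le_size_mul {n D p : ℕ} {c : ℕ → ℝ} {β : ℝ} (hβ : 0 ≤ β)
    (hann : ∀ v ≤ D, ∑ w ∈ Finset.range (n + 1), c w * w.choose v = 0)
    (hpar : ∀ w, c w ≠ 0 → w % 2 = p)
    (hmid : ∀ w j, c w ≠ 0 → w ≤ n → D < j → j + D < n →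
      (2 : ℝ) ^ n ≤ β ^ 2 * (n.choose w * n.choose j))
    {F : ℕ → ℤˣ} {t : ParityDecisionTree n} (ht : ∀ x, t.eval x = F (hammingWeight x)) :
    |∑ w ∈ Finset.range (n + 1), c w * ((F w : ℤ) : ℝ)| ≤
      t.size * (β * ∑ w ∈ Finset.range (n + 1), |c w|) := by
  have h := t.abs_sum_mul_eval_le (abs_sum_layers_mul_walsh_le hβ hann hpar hmid) ∅
  refine le_of_eq_of_le (congrArg _ ?_) h
  have h1 : ∀ U : Finset (Fin n), c U.card / n.choose U.card * walsh ∅ U *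
      ((t.eval (cubePoint U) : ℤ) : ℝ) =
      (c U.card / n.choose U.card * ((F U.card : ℤ) : ℝ)) * 1 := by
    intro U
    rw [ht, hammingWeight_cubePoint]
    simp [walsh]
  simp only [h1]
  rw [sum_card_eq_sum_range (fun w => c w / n.choose w * ((F w : ℤ) : ℝ)) fun _ => 1]
  refine Finset.sum_congr rfl fun w hw => ?_
  have h0 : (n.choose w : ℝ) ≠ 0 := by
    have : w ≤ n := by simpa [Nat.lt_succ_iff] using hw
    exact_mod_cast (Nat.choose_pos this).ne'
  simp
  field_simp

/-! ### The dual functional -/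

-- The sum is, up to sign, the `N`-th forward difference of `Q` at `0`.
open Polynomial in
theorem sum_alternating_choose_mul_eval_eq_zero {N : ℕ} {Q : ℝ[X]} (hQ : Q.natDegree < N) :
    ∑ k ∈ Finset.range (N + 1), (-1 : ℝ) ^ k * N.choose k * Q.eval (k : ℝ) = 0 := by
  have h := congrFun (Polynomial.fwdDiff_iter_eq_zero_of_degree_lt hQ) 0
  rw [fwdDiff_iter_eq_sum_shift] at h
  have h2 : (-1 : ℝ) ^ N * ∑ k ∈ Finset.range (N + 1),
      (-1 : ℝ) ^ k * N.choose k * Q.eval (k : ℝ) = 0 := by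
    rw [Finset.mul_sum, ← Pi.zero_apply (M := fun _ : ℝ => ℝ) (0 : ℝ), ← h]
    refine Finset.sum_congr rfl fun k hk => ?_
    have hk : k ≤ N := by simpa [Nat.lt_succ_iff] using hk
    obtain ⟨i, rfl⟩ := Nat.exists_eq_add_of_le hk
    have e : (-1 : ℝ) ^ (k + i) * (-1) ^ k = (-1) ^ i := by
      rw [pow_add, mul_right_comm, ← mul_pow]
      simp
    simp only [add_tsub_cancel_left, zsmul_eq_mul, nsmul_eq_mul, mul_one, zero_add]
    push_cast
    rw [← mul_assoc, ← mul_assoc, e]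
  exact (mul_eq_zero.mp h2).resolve_left (pow_ne_zero _ (by norm_num))

/-- The coefficients of a functional that annihilates polynomials of low degree and has most
of its mass at the points `-2, 0, 2`: these are the values at `6 * (k - L)`. -/
noncomputable def dualCoeff (L k : ℕ) : ℝ :=
  (-1) ^ (k + L) * (2 * L).choose k / (9 * ((k : ℝ) - L) ^ 2 - 1)

noncomputable def dualTotal (L : ℕ) : ℝ := ∑ k ∈ Finset.range (2 * L + 1), dualCoeff L k

theorem nine_mul_sq_sub_one_ne_zero (k L : ℕ) : 9 * ((k : ℝ) - L) ^ 2 - 1 ≠ 0 := by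
  have h : (9 * ((k : ℤ) - L) ^ 2 - 1) ≠ 0 := by omega
  exact_mod_cast h

theorem dualCoeff_self (L : ℕ) : dualCoeff L L = - (2 * L).choose L := by
  simp [dualCoeff, ← two_mul, div_neg]

/-- The coefficients are invariant under `k ↦ 2 * L - k`, while `k - L` changes sign. -/
theorem sum_dualCoeff_mul_sub (L : ℕ) :
    ∑ k ∈ Finset.range (2 * L + 1), dualCoeff L k * ((k : ℝ) - L) = 0 := by
  have h := Finset.sum_range_reflect (fun k => dualCoeff L k * ((k : ℝ) - L)) (2 * L + 1)
  have h2 : ∑ k ∈ Finset.range (2 * L + 1),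
      (fun k => dualCoeff L k * ((k : ℝ) - L)) (2 * L + 1 - 1 - k) =
      - ∑ k ∈ Finset.range (2 * L + 1), dualCoeff L k * ((k : ℝ) - L) := by
    rw [← Finset.sum_neg_distrib]
    refine Finset.sum_congr rfl fun k hk => ?_
    have hk : k ≤ 2 * L := by simpa [Nat.lt_succ_iff] using hk
    obtain ⟨i, hi⟩ := Nat.exists_eq_add_of_le hk
    have hr : (2 * (L : ℝ)) = k + i := by exact_mod_cast hi
    have e1 : 2 * L + 1 - 1 - k = i := by omega
    have e2 : (i : ℝ) - L = -((k : ℝ) - L) := by linarith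
    have e3 : (2 * L).choose i = (2 * L).choose k := Nat.choose_symm_of_eq_add (by omega)
    have e4 : (-1 : ℝ) ^ (i + L) = (-1) ^ (k + L) := by
      rw [neg_one_pow_eq_pow_mod_two, neg_one_pow_eq_pow_mod_two (k + L)]
      congr 1
      omega
    simp only [e1, dualCoeff, e2, e3, e4, neg_sq]
    ring
  linarith

-- Divide `P` by `X ^ 2 - 4`. At `6 * (k - L)` the divisor is four times the denominator of
-- `dualCoeff`, so the quotient meets a plain alternating binomial sum and disappears. Of the linear
-- remainder only the constant term survives, and this is the mean of `P 2` and `P (-2)`.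
open Polynomial in
theorem sum_dualCoeff_mul_eval {L : ℕ} (hL : 1 ≤ L) {P : ℝ[X]} (hP : P.natDegree ≤ 2 * L) :
    ∑ k ∈ Finset.range (2 * L + 1), dualCoeff L k * P.eval (6 * ((k : ℝ) - L)) =
      dualTotal L / 2 * (P.eval 2 + P.eval (-2)) := by
  set q : ℝ[X] := X ^ 2 - C 4 with hq
  have hqm : q.Monic := monic_X_pow_sub_C 4 (by norm_num)
  have hqd : q.natDegree = 2 := natDegree_X_pow_sub_C
  set Q := P /ₘ q with hQ
  set R := P %ₘ q with hR
  have hQd : Q.natDegree < 2 * L := by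
    rw [hQ, natDegree_divByMonic P hqm, hqd]
    omega
  have hRd : R.natDegree ≤ 1 := by
    have := natDegree_modByMonic_lt P hqm (by
      intro h
      rw [h, natDegree_one] at hqd
      omega)
    rw [← hR, hqd] at this
    omega
  have hPe : ∀ y, P.eval y = R.coeff 1 * y + R.coeff 0 + (y ^ 2 - 4) * Q.eval y := by
    intro y
    conv_lhs => rw [← modByMonic_add_div P q]
    rw [← hR, ← hQ, eval_add, eval_mul]
    conv_lhs => rw [eq_X_add_C_of_natDegree_le_one hRd]
    simp [hq]
  have hzero : ∑ k ∈ Finset.range (2 * L + 1),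
      dualCoeff L k * (((6 * ((k : ℝ) - L)) ^ 2 - 4) * Q.eval (6 * ((k : ℝ) - L))) = 0 := by
    have hc : (Q.comp (C 6 * X - C (6 * (L : ℝ)))).natDegree < 2 * L := by
      refine lt_of_le_of_lt natDegree_comp_le ?_
      have : (C (6 : ℝ) * X - C (6 * (L : ℝ))).natDegree ≤ 1 := by
        rw [natDegree_sub_C]
        exact (natDegree_C_mul_le _ _).trans natDegree_X_le
      nlinarith
    have h := sum_alternating_choose_mul_eval_eq_zero hc
    have h2 : ∀ k ∈ Finset.range (2 * L + 1),
        dualCoeff L k * (((6 * ((k : ℝ) - L)) ^ 2 - 4) * Q.eval (6 * ((k : ℝ) - L))) =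
        4 * (-1) ^ L * ((-1 : ℝ) ^ k * (2 * L).choose k *
          (Q.comp (C 6 * X - C (6 * (L : ℝ)))).eval (k : ℝ)) := by
      intro k _
      have hne := nine_mul_sq_sub_one_ne_zero k L
      have e : (Q.comp (C 6 * X - C (6 * (L : ℝ)))).eval (k : ℝ) =
          Q.eval (6 * ((k : ℝ) - L)) := by
        simp [eval_comp, mul_sub]
      rw [e, dualCoeff, show (6 * ((k : ℝ) - L)) ^ 2 - 4 = 4 * (9 * ((k : ℝ) - L) ^ 2 - 1) by
        ring, pow_add]
      field_simp
    rw [Finset.sum_congr rfl h2, ← Finset.mul_sum, h, mul_zero]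
  simp only [hPe]
  have e : ∀ k ∈ Finset.range (2 * L + 1), dualCoeff L k * (R.coeff 1 * (6 * ((k : ℝ) - L)) +
      R.coeff 0 + ((6 * ((k : ℝ) - L)) ^ 2 - 4) * Q.eval (6 * ((k : ℝ) - L))) =
      6 * R.coeff 1 * (dualCoeff L k * ((k : ℝ) - L)) + R.coeff 0 * dualCoeff L k +
      dualCoeff L k * (((6 * ((k : ℝ) - L)) ^ 2 - 4) * Q.eval (6 * ((k : ℝ) - L))) :=
    fun k _ => by ring
  rw [Finset.sum_congr rfl e, Finset.sum_add_distrib, Finset.sum_add_distrib, hzero,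
    ← Finset.mul_sum, ← Finset.mul_sum, sum_dualCoeff_mul_sub, ← dualTotal]
  ring

/-- Spacing `6` against the points `±2` gives the denominators `9 * j ^ 2 - 1`, which are at least
twice those of the telescoping series of `1 / (4 * j ^ 2 - 1)`. Hence the central coefficient
outweighs all the others. -/
theorem sum_abs_dualCoeff_erase_le (L : ℕ) :
    ∑ k ∈ (Finset.range (2 * L + 1)).erase L, |dualCoeff L k| ≤ (2 * L).choose L / 2 := by
  set τ : ℕ → ℝ := fun k => -(1 / (2 * (2 * ((k : ℝ) - L) - 1))) with hτ
  have hterm : ∀ k : ℕ, τ (k + 1) - τ k = 1 / (4 * ((k : ℝ) - L) ^ 2 - 1) := by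
    intro k
    have h1 : 2 * ((k : ℝ) - L) - 1 ≠ 0 := by
      have h : (2 * ((k : ℤ) - L) - 1) ≠ 0 := by omega
      exact_mod_cast h
    have h2 : 2 * ((k : ℝ) - L) + 1 ≠ 0 := by
      have h : (2 * ((k : ℤ) - L) + 1) ≠ 0 := by omega
      exact_mod_cast h
    have h3 : 4 * ((k : ℝ) - L) ^ 2 - 1 = (2 * ((k : ℝ) - L) - 1) * (2 * ((k : ℝ) - L) + 1) := by
      ring
    have h4 : 2 * (((k + 1 : ℕ) : ℝ) - L) - 1 = 2 * ((k : ℝ) - L) + 1 := by push_cast; ring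
    simp only [hτ]
    rw [h3, h4]
    field_simp
    ring
  -- The full telescoping sum is not positive, and its term at `k = L` is `-1`.
  have hsum : ∑ k ∈ (Finset.range (2 * L + 1)).erase L, 1 / (4 * ((k : ℝ) - L) ^ 2 - 1) ≤ 1 := by
    have hmem : L ∈ Finset.range (2 * L + 1) := by simp; omega
    have h := Finset.add_sum_erase _ (fun k : ℕ => 1 / (4 * ((k : ℝ) - L) ^ 2 - 1)) hmem
    have htel : ∑ k ∈ Finset.range (2 * L + 1), 1 / (4 * ((k : ℝ) - L) ^ 2 - 1) ≤ 0 := by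
      rw [← Finset.sum_congr rfl fun k _ => hterm k, Finset.sum_range_sub]
      have e1 : τ (2 * L + 1) = -(1 / (2 * (2 * L + 1))) := by
        simp only [hτ]; push_cast; ring_nf
      have e2 : τ 0 = 1 / (2 * (2 * L + 1)) := by
        simp only [hτ]
        rw [show 2 * (2 * (((0 : ℕ) : ℝ) - L) - 1) = -(2 * (2 * L + 1)) by push_cast; ring,
          div_neg, neg_neg]
      have : (0 : ℝ) ≤ 1 / (2 * (2 * L + 1)) := by positivity
      rw [e1, e2]
      linarith
    simp only [sub_self] at h
    norm_num at h
    norm_num at htel ⊢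
    linarith
  have hle : ∀ k ∈ (Finset.range (2 * L + 1)).erase L, |dualCoeff L k| ≤
      (2 * L).choose L / 2 * (1 / (4 * ((k : ℝ) - L) ^ 2 - 1)) := by
    intro k hk
    have hkL : (k : ℤ) - L ≠ 0 := by
      have := Finset.ne_of_mem_erase hk
      omega
    have h1 : (1 : ℝ) ≤ ((k : ℝ) - L) ^ 2 := by
      have : (1 : ℤ) ≤ ((k : ℤ) - L) ^ 2 := by
        have := sq_pos_of_ne_zero hkL
        omega
      exact_mod_cast this
    have h2 : ((2 * L).choose k : ℝ) ≤ (2 * L).choose L := by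
      exact_mod_cast Nat.choose_le_centralBinom k L
    rw [dualCoeff, abs_div, abs_mul, abs_pow, abs_neg, abs_one, one_pow, one_mul,
      Nat.abs_cast, abs_of_pos (by linarith : (0 : ℝ) < 9 * ((k : ℝ) - L) ^ 2 - 1)]
    rw [div_mul_div_comm, mul_one, div_le_div_iff₀ (by linarith) (by linarith)]
    have h3 : (0 : ℝ) ≤ (2 * L).choose L := by positivity
    calc ((2 * L).choose k : ℝ) * (2 * (4 * ((k : ℝ) - L) ^ 2 - 1))
        ≤ (2 * L).choose L * (2 * (4 * ((k : ℝ) - L) ^ 2 - 1)) := by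
          gcongr
          linarith
      _ ≤ _ := by
          gcongr
          linarith
  refine (Finset.sum_le_sum hle).trans ?_
  rw [← Finset.mul_sum]
  have h3 : (0 : ℝ) ≤ (2 * L).choose L / 2 := by positivity
  nlinarith

theorem exists_polynomial_eval_eq_choose (v : ℕ) :
    ∃ P : Polynomial ℝ, P.natDegree ≤ v ∧ ∀ w : ℕ, P.eval (w : ℝ) = w.choose v := by
  refine ⟨Polynomial.C (1 / (v.factorial : ℝ)) * descPochhammer ℝ v, ?_, fun w => ?_⟩
  · refine (Polynomial.natDegree_C_mul_le _ _).trans ?_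
    rw [descPochhammer_natDegree]
  · have h : (v.factorial : ℝ) ≠ 0 := by exact_mod_cast v.factorial_ne_zero
    rw [Polynomial.eval_mul, Polynomial.eval_C, descPochhammer_eval_eq_descFactorial,
      Nat.descFactorial_eq_factorial_mul_choose]
    push_cast
    field_simp

/-! ### Binomial estimates in dimension `240 * L` -/

/-- Within distance `7 * L` of the middle, consecutive binomial coefficients have ratio at least `7
/ 8`. -/
theorem seven_pow_mul_choose_le {L i : ℕ} (hi : i ≤ 7 * L) :
    7 ^ i * (2 * (120 * L)).choose (120 * L) ≤
      8 ^ i * (2 * (120 * L)).choose (120 * L - i) := by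
  induction i with
  | zero => simp
  | succ i ih =>
    have ih := ih (by omega)
    have h := Nat.choose_succ_right_eq (2 * (120 * L)) (120 * L - (i + 1))
    rw [show 120 * L - (i + 1) + 1 = 120 * L - i by omega,
      show 2 * (120 * L) - (120 * L - (i + 1)) = 120 * L + i + 1 by omega] at h
    have h2 : 7 * (120 * L + i + 1) ≤ 8 * (120 * L - i) := by omega
    set A := (2 * (120 * L)).choose (120 * L - i)
    set B := (2 * (120 * L)).choose (120 * L - (i + 1))
    have hpos : 0 < 120 * L - i := by omega
    have h3 : 7 * A ≤ 8 * B := by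
      refine Nat.le_of_mul_le_mul_right (c := 120 * L - i) ?_ hpos
      calc 7 * A * (120 * L - i) = B * (7 * (120 * L + i + 1)) := by rw [mul_assoc, h]; ring
        _ ≤ B * (8 * (120 * L - i)) := Nat.mul_le_mul_left _ h2
        _ = _ := by ring
    calc 7 ^ (i + 1) * (2 * (120 * L)).choose (120 * L)
        = 7 * (7 ^ i * (2 * (120 * L)).choose (120 * L)) := by ring
      _ ≤ 7 * (8 ^ i * A) := Nat.mul_le_mul_left _ ih
      _ = 8 ^ i * (7 * A) := by ring
      _ ≤ 8 ^ i * (8 * B) := Nat.mul_le_mul_left _ h3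
      _ = _ := by ring

theorem choose_middle_le {L w : ℕ} (h1 : 120 * L ≤ w + 7 * L) (h2 : w ≤ 127 * L) :
    (2 * (120 * L)).choose (120 * L) ≤ 3 ^ L * (2 * (120 * L)).choose w := by
  wlog hw : w ≤ 120 * L generalizing w
  · have h := this (w := 240 * L - w) (by omega) (by omega) (by omega)
    rwa [Nat.choose_symm_of_eq_add (show 2 * (120 * L) = (240 * L - w) + w by omega)] at h
  have h := choose_le_choose_of_le_half (n := 2 * (120 * L)) (k := 120 * L - 7 * L) (l := w)
    (by omega) (by omega)
  have h7 := seven_pow_mul_choose_le (L := L) (i := 7 * L) le_rfl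
  -- `(8 / 7) ^ 7 < 3`.
  have h8 : (8 : ℕ) ^ (7 * L) ≤ 7 ^ (7 * L) * 3 ^ L := by
    rw [pow_mul, pow_mul, ← mul_pow]
    exact Nat.pow_le_pow_left (by norm_num) _
  refine Nat.le_of_mul_le_mul_left (c := 7 ^ (7 * L)) ?_ (by positivity)
  calc 7 ^ (7 * L) * (2 * (120 * L)).choose (120 * L)
      ≤ 8 ^ (7 * L) * (2 * (120 * L)).choose (120 * L - 7 * L) := h7
    _ ≤ 7 ^ (7 * L) * 3 ^ L * (2 * (120 * L)).choose w := Nat.mul_le_mul h8 h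
    _ = _ := by ring

/-- By symmetry and monotonicity the worst case is `j = 2 * L`, where the coefficient is at least
`((238 * L) / (2 * L)) ^ (2 * L) = 119 ^ (2 * L)`, and `119 ^ 2 = 14161`. -/
theorem pow_le_choose_of_mid {L j : ℕ} (h1 : 2 * L ≤ j) (h2 : j + 2 * L ≤ 240 * L) :
    14161 ^ L ≤ (2 * (120 * L)).choose j := by
  wlog hj : j ≤ 120 * L generalizing j
  · have h := this (j := 240 * L - j) (by omega) (by omega) (by omega)
    rwa [Nat.choose_symm_of_eq_add (show 2 * (120 * L) = (240 * L - j) + j by omega)] at h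
  refine le_trans ?_ (choose_le_choose_of_le_half h1 (by omega))
  rcases Nat.eq_zero_or_pos L with rfl | hL
  · simp
  have h3 := Nat.pow_sub_le_descFactorial (2 * (120 * L)) (2 * L)
  rw [Nat.descFactorial_eq_factorial_mul_choose] at h3
  have h4 : (2 * L).factorial ≤ (2 * L) ^ (2 * L) := Nat.factorial_le_pow _
  refine Nat.le_of_mul_le_mul_left (c := (2 * L) ^ (2 * L)) ?_ (by positivity)
  calc (2 * L) ^ (2 * L) * 14161 ^ L = (2 * L * 119) ^ (2 * L) := by
        rw [mul_pow (2 * L), pow_mul 119]; norm_num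
    _ ≤ (2 * (120 * L) + 1 - 2 * L) ^ (2 * L) := Nat.pow_le_pow_left (by omega) _
    _ ≤ _ := h3
    _ ≤ _ := Nat.mul_le_mul_right _ h4

/-- Layer `w` has at least `4 ^ (120 * L) / (240 * L * 3 ^ L)` points, so the other factor must beat
`36 * 240 * L * 12 ^ L`; there is room because `12 * 1180 = 14160 < 14161`. -/
theorem four_pow_le_choose_mul_choose {L w j : ℕ} (hL : 2 ≤ L)
    (h1 : 120 * L ≤ w + 7 * L) (h2 : w ≤ 127 * L) (h3 : 2 * L ≤ j)
    (h4 : j + 2 * L ≤ 240 * L) :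
    36 * 4 ^ L * 2 ^ (2 * (120 * L)) ≤
      (2 * (120 * L)).choose w * (2 * (120 * L)).choose j := by
  have hw := choose_middle_le h1 h2
  have hj := pow_le_choose_of_mid h3 h4
  have hc := Nat.four_pow_le_two_mul_self_mul_centralBinom (120 * L) (by omega)
  rw [Nat.centralBinom] at hc
  have hbig : 8640 * L ≤ 1180 ^ L := by
    clear h1 h2 h3 h4 hw hj hc
    induction L, hL using Nat.le_induction with
    | base => norm_num
    | succ L hL ih => rw [pow_succ]; omega
  have hL12 : 8640 * L * 12 ^ L ≤ 14161 ^ L := by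
    calc 8640 * L * 12 ^ L ≤ 1180 ^ L * 12 ^ L := Nat.mul_le_mul_right _ hbig
      _ = 14160 ^ L := by rw [← mul_pow]; norm_num
      _ ≤ _ := Nat.pow_le_pow_left (by norm_num) _
  calc 36 * 4 ^ L * 2 ^ (2 * (120 * L)) = 36 * 4 ^ L * 4 ^ (120 * L) := by
        rw [pow_mul 2 2]; norm_num
    _ ≤ 36 * 4 ^ L * (2 * (120 * L) * (3 ^ L * (2 * (120 * L)).choose w)) :=
        Nat.mul_le_mul_left _ (hc.trans (Nat.mul_le_mul_left _ hw))
    _ = (2 * (120 * L)).choose w * (8640 * L * 12 ^ L) := by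
        rw [show (12 : ℕ) = 4 * 3 by norm_num, mul_pow]; ring
    _ ≤ _ := Nat.mul_le_mul_left _ (hL12.trans hj)

/-! ### The lower bound for a jump in the middle -/

/-- The signed combination of layers of a cube of dimension `240 * L` that is given by
`dualCoeff`, with the two further layers `120 * L + 1` and `120 * L - 3`. -/
noncomputable def dualLayer (L w : ℕ) : ℝ :=
  (∑ k ∈ Finset.range (2 * L + 1), if w = 114 * L - 1 + 6 * k then dualCoeff L k else 0) +
  ((if w = 120 * L + 1 then - dualTotal L / 2 else 0) +
    (if w = 120 * L - 3 then - dualTotal L / 2 else 0))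

theorem sum_dualLayer_mul {L : ℕ} (hL : 1 ≤ L) (G : ℕ → ℝ) :
    ∑ w ∈ Finset.range (2 * (120 * L) + 1), dualLayer L w * G w =
      ∑ k ∈ Finset.range (2 * L + 1), dualCoeff L k * G (114 * L - 1 + 6 * k) -
        dualTotal L / 2 * (G (120 * L + 1) + G (120 * L - 3)) := by
  simp only [dualLayer, add_mul, Finset.sum_mul, ite_mul, zero_mul, Finset.sum_add_distrib]
  rw [Finset.sum_comm, Finset.sum_ite_eq', Finset.sum_ite_eq',
    if_pos (by simp only [Finset.mem_range]; omega),
    if_pos (by simp only [Finset.mem_range]; omega)]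
  have : ∀ k ∈ Finset.range (2 * L + 1), (∑ w ∈ Finset.range (2 * (120 * L) + 1),
      if w = 114 * L - 1 + 6 * k then dualCoeff L k * G w else 0) =
      dualCoeff L k * G (114 * L - 1 + 6 * k) := by
    intro k hk
    rw [Finset.sum_ite_eq', if_pos]
    simp only [Finset.mem_range] at hk ⊢
    omega
  rw [Finset.sum_congr rfl this]
  ring

/-- The substitution `w = 120 * L - 1 + y` takes the nodes `6 * (k - L)`, `2` and `-2` to the layers
of `dualLayer`, so this is `sum_dualCoeff_mul_eval` for a shifted binomial polynomial. -/
theorem sum_dualLayer_mul_choose {L : ℕ} (hL : 1 ≤ L) {v : ℕ} (hv : v ≤ 2 * L) :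
    ∑ w ∈ Finset.range (2 * (120 * L) + 1), dualLayer L w * w.choose v = 0 := by
  obtain ⟨P, hP, hPe⟩ := exists_polynomial_eval_eq_choose v
  rw [sum_dualLayer_mul hL fun w => (w.choose v : ℝ)]
  simp only [← hPe]
  set P' := P.comp (Polynomial.X + Polynomial.C (120 * (L : ℝ) - 1)) with hP'
  have hd : P'.natDegree ≤ 2 * L := by
    refine Polynomial.natDegree_comp_le.trans ?_
    rw [Polynomial.natDegree_X_add_C, mul_one]
    omega
  have h := sum_dualCoeff_mul_eval hL hd
  have he : ∀ y, P'.eval y = P.eval (y + (120 * (L : ℝ) - 1)) := by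
    intro y
    simp [hP', Polynomial.eval_comp]
  simp only [he] at h
  rw [sub_eq_zero]
  convert h using 3 with k _
  · congr 1
    rw [Nat.cast_add, Nat.cast_sub (by omega)]
    push_cast
    ring
  · congr 1
    push_cast
    ring
  · congr 1
    rw [Nat.cast_sub (by omega)]
    push_cast
    ring

theorem dualLayer_ne_zero {L w : ℕ} (hL : 1 ≤ L) (h : dualLayer L w ≠ 0) :
    w % 2 = 1 ∧ 120 * L ≤ w + 7 * L ∧ w ≤ 127 * L := by
  by_contra hn
  refine h ?_
  rw [dualLayer, Finset.sum_eq_zero, if_neg, if_neg]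
  · ring
  · rintro rfl
    omega
  · rintro rfl
    omega
  · intro k hk
    rw [if_neg]
    rintro rfl
    rw [Finset.mem_range] at hk
    omega

theorem sum_abs_dualLayer_le (L : ℕ) (s : Finset ℕ) :
    ∑ w ∈ s, |dualLayer L w| ≤
      ∑ k ∈ Finset.range (2 * L + 1), |dualCoeff L k| + |dualTotal L| := by
  have hite : ∀ (a : ℕ) (d : ℝ), ∑ w ∈ s, |if w = a then d else 0| ≤ |d| := by
    intro a d
    simp only [apply_ite abs, abs_zero]
    rw [Finset.sum_ite_eq']
    split_ifs
    · exact le_rfl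
    · exact abs_nonneg d
  calc ∑ w ∈ s, |dualLayer L w|
      ≤ ∑ w ∈ s, ((∑ k ∈ Finset.range (2 * L + 1),
            |if w = 114 * L - 1 + 6 * k then dualCoeff L k else 0|) +
          (|if w = 120 * L + 1 then - dualTotal L / 2 else 0| +
            |if w = 120 * L - 3 then - dualTotal L / 2 else 0|)) := by
        refine Finset.sum_le_sum fun w _ => (abs_add_le _ _).trans ?_
        gcongr
        · exact Finset.abs_sum_le_sum_abs _ _
        · exact abs_add_le _ _
    _ ≤ ∑ k ∈ Finset.range (2 * L + 1), |dualCoeff L k| +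
          (|(- dualTotal L / 2)| + |(- dualTotal L / 2)|) := by
        rw [Finset.sum_add_distrib, Finset.sum_add_distrib, Finset.sum_comm]
        gcongr
        · exact hite _ _
        · exact hite _ _
        · exact hite _ _
    _ = _ := by
        rw [abs_div, abs_neg, abs_two]
        ring

/-- A symmetric function that takes different values on the layers `a - 1` and `a + 1` of a
cube of dimension `2 * a` has exponential parity decision tree size. -/
theorem two_pow_le_size_of_middle_jump {L : ℕ} (hL : 2 ≤ L) {F : ℕ → ℤˣ}
    {t : ParityDecisionTree (2 * (120 * L))} (ht : ∀ x, t.eval x = F (hammingWeight x))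
    (hF : F (120 * L + 1) ≠ F (120 * L - 1)) : 2 ^ L ≤ t.size := by
  have hL1 : 1 ≤ L := by omega
  -- The `6` cancels the ratio between the norm, at most `3 * Φ`, and the correlation, at least `Φ /
  -- 2`.
  have hβ : (0 : ℝ) ≤ (1 / 2) ^ L / 6 := by positivity
  have h := abs_sum_layers_le_size_mul (D := 2 * L) (p := 1) (c := dualLayer L) hβ
    (fun v hv => sum_dualLayer_mul_choose hL1 hv)
    (fun w hw => (dualLayer_ne_zero hL1 hw).1)
    (fun w j hw _ h1 h2 => by
      obtain ⟨-, hw1, hw2⟩ := dualLayer_ne_zero hL1 hw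
      have h := four_pow_le_choose_mul_choose (j := j) hL hw1 hw2 (by omega) (by omega)
      have h' : (36 * 4 ^ L * 2 ^ (2 * (120 * L)) : ℝ) ≤
        (2 * (120 * L)).choose w * (2 * (120 * L)).choose j := by exact_mod_cast h
      have h4 : (4 : ℝ) ^ L = (2 ^ L) ^ 2 := by
        rw [← pow_mul, mul_comm, pow_mul]; norm_num
      have hsq : ((1 / 2 : ℝ) ^ L / 6) ^ 2 = 1 / (36 * 4 ^ L) := by
        rw [one_div_pow, h4, div_div, one_div_pow, mul_pow]; ring
      rw [hsq, div_mul_eq_mul_div, one_mul, le_div_iff₀ (by positivity), mul_comm]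
      exact h') ht
  rw [sum_dualLayer_mul hL1 fun w => ((F w : ℤ) : ℝ)] at h
  have hmem : L ∈ Finset.range (2 * L + 1) := by simp only [Finset.mem_range]; omega
  set Φ : ℝ := ((2 * L).choose L : ℝ) with hΦ
  have hΦ0 : 0 < Φ := by
    rw [hΦ]
    exact_mod_cast Nat.choose_pos (by omega)
  have herase := sum_abs_dualCoeff_erase_le L
  rw [← hΦ] at herase
  have hcL : dualCoeff L L = -Φ := dualCoeff_self L
  have hunit : ∀ w, |((F w : ℤ) : ℝ)| = 1 := by
    intro w
    rcases Int.units_eq_one_or (F w) with h | h <;> simp [h]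
  have htot : |dualTotal L + Φ| ≤ Φ / 2 := by
    rw [dualTotal, ← Finset.add_sum_erase _ _ hmem, hcL, neg_add_cancel_comm]
    exact (Finset.abs_sum_le_sum_abs _ _).trans herase
  have htot' := abs_le.mp htot
  have habs : ∑ k ∈ Finset.range (2 * L + 1), |dualCoeff L k| ≤ 3 / 2 * Φ := by
    rw [← Finset.add_sum_erase _ _ hmem, hcL, abs_neg, abs_of_pos hΦ0]
    linarith
  have hnorm : ∑ w ∈ Finset.range (2 * (120 * L) + 1), |dualLayer L w| ≤ 3 * Φ := by
    refine (sum_abs_dualLayer_le L _).trans ?_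
    have : |dualTotal L| ≤ 3 / 2 * Φ := abs_le.mpr ⟨by linarith, by linarith⟩
    linarith
  -- Between the layers `120 * L - 1` and `120 * L + 1` both the coefficient and the value of `F`
  -- change sign, so their contributions add up. Layer `120 * L - 3` can at most cancel that of `120
  -- * L + 1`, which leaves `Φ` against a remaining mass of at most `Φ / 2`.
  have hcorr : Φ / 2 ≤ |∑ k ∈ Finset.range (2 * L + 1),
      dualCoeff L k * ((F (114 * L - 1 + 6 * k) : ℤ) : ℝ) -
        dualTotal L / 2 * (((F (120 * L + 1) : ℤ) : ℝ) + ((F (120 * L - 3) : ℤ) : ℝ))| := by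
    rw [← Finset.add_sum_erase _ _ hmem, hcL,
      show 114 * L - 1 + 6 * L = 120 * L - 1 by omega]
    have hrest : |∑ k ∈ (Finset.range (2 * L + 1)).erase L,
        dualCoeff L k * ((F (114 * L - 1 + 6 * k) : ℤ) : ℝ)| ≤ Φ / 2 := by
      refine (Finset.abs_sum_le_sum_abs _ _).trans (le_trans ?_ herase)
      refine Finset.sum_le_sum fun k _ => ?_
      rw [abs_mul, hunit, mul_one]
    have hrest' := abs_le.mp hrest
    set X := ∑ k ∈ (Finset.range (2 * L + 1)).erase L,
      dualCoeff L k * ((F (114 * L - 1 + 6 * k) : ℤ) : ℝ)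
    rcases Int.units_eq_one_or (F (120 * L - 1)) with h1 | h1 <;>
      rcases Int.units_eq_one_or (F (120 * L + 1)) with h2 | h2
    · exact absurd (h2.trans h1.symm) hF
    · rw [h1, h2, le_abs]
      right
      rcases Int.units_eq_one_or (F (120 * L - 3)) with h3 | h3 <;> rw [h3] <;> push_cast <;>
        linarith
    · rw [h1, h2, le_abs]
      left
      rcases Int.units_eq_one_or (F (120 * L - 3)) with h3 | h3 <;> rw [h3] <;> push_cast <;>
        linarith
    · exact absurd (h2.trans h1.symm) hF
  have hfin : Φ / 2 ≤ t.size * ((1 / 2) ^ L / 6 * (3 * Φ)) :=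
    (hcorr.trans h).trans (by gcongr)
  have h2 : (1 : ℝ) ≤ t.size * (1 / 2) ^ L := by
    refine le_of_mul_le_mul_right ?_ (half_pos hΦ0)
    linarith
  rw [one_div_pow, mul_one_div, le_div_iff₀ (by positivity), one_mul] at h2
  exact_mod_cast h2

/-! ### Restricting and reflecting trees -/

namespace ParityDecisionTree

/-- Trees can be pulled back along affine maps of cubes. -/
theorem exists_pullback {m n : ℕ} (φ : (Fin m → ZMod 2) → (Fin n → ZMod 2))
    (hφ : ∀ S : Finset (Fin n), ∃ (S' : Finset (Fin m)) (b : ZMod 2),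
      ∀ z, ∑ i ∈ S, φ z i = ∑ i ∈ S', z i + b) (t : ParityDecisionTree n) :
    ∃ t' : ParityDecisionTree m, t'.size = t.size ∧ ∀ z, t'.eval z = t.eval (φ z) := by
  induction t with
  | leaf v => exact ⟨leaf v, rfl, fun z => rfl⟩
  | node S t₀ t₁ ih₀ ih₁ =>
    obtain ⟨t₀', hs₀, h₀⟩ := ih₀
    obtain ⟨t₁', hs₁, h₁⟩ := ih₁
    obtain ⟨S', b, hS⟩ := hφ S
    by_cases hb : b = 0
    · refine ⟨node S' t₀' t₁', by simp only [size, hs₀, hs₁], fun z => ?_⟩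
      simp only [eval, hS, hb, add_zero, h₀, h₁]
    · refine ⟨node S' t₁' t₀', by simp only [size, hs₀, hs₁, add_comm], fun z => ?_⟩
      have key : ∀ a : ZMod 2, a + 1 = 0 ↔ ¬ a = 0 := by decide
      simp only [eval, hS, ZMod.two_eq_one_of_ne_zero hb, key, h₀, h₁, ite_not]

theorem exists_cons {m : ℕ} (c : ZMod 2) (t : ParityDecisionTree (m + 1)) :
    ∃ t' : ParityDecisionTree m, t'.size = t.size ∧
      ∀ z, t'.eval z = t.eval (Fin.cons c z) := by
  refine exists_pullback (fun z => Fin.cons c z) (fun S => ?_) t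
  refine ⟨Finset.univ.filter fun j => j.succ ∈ S, if 0 ∈ S then c else 0, fun z => ?_⟩
  rw [Finset.sum_filter, ← Finset.univ_inter S, ← Finset.sum_ite_mem, Fin.sum_univ_succ]
  simp [add_comm]

end ParityDecisionTree

theorem hammingWeight_cons {m : ℕ} (c : ZMod 2) (z : Fin m → ZMod 2) :
    hammingWeight (Fin.cons c z : Fin (m + 1) → ZMod 2) =
      hammingWeight z + if c = 1 then 1 else 0 := by
  simp only [hammingWeight, Finset.card_filter, Fin.sum_univ_succ, Fin.cons_zero, Fin.cons_succ]
  rw [add_comm]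

theorem hammingWeight_add_one {n : ℕ} (x : Fin n → ZMod 2) :
    hammingWeight (x + 1) = n - hammingWeight x := by
  have h := Finset.card_filter_add_card_filter_not (s := (Finset.univ : Finset (Fin n)))
    (fun i => x i = 1)
  have e : (Finset.univ.filter fun i => (x + 1) i = 1) =
      Finset.univ.filter fun i => ¬ x i = 1 := by
    ext i
    simp only [Finset.mem_filter, Finset.mem_univ, true_and, Pi.add_apply, Pi.one_apply]
    generalize x i = a
    revert a
    decide
  rw [hammingWeight, e, hammingWeight]
  rw [Finset.card_univ, Fintype.card_fin] at h
  omega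

/-- Some tree of size `s` computes the symmetric function of `n` variables with values `F`. -/
def LayerTree (n : ℕ) (F : ℕ → ℤˣ) (s : ℕ) : Prop :=
  ∃ t : ParityDecisionTree n, t.size = s ∧ ∀ x, t.eval x = F (hammingWeight x)

theorem LayerTree.fix_zeros {n s : ℕ} {F : ℕ → ℤˣ} : ∀ {q : ℕ}, LayerTree (n + q) F s →
    LayerTree n F s
  | 0, h => h
  | q + 1, ⟨t, hs, ht⟩ => by
    obtain ⟨t', hs', ht'⟩ := t.exists_cons 0
    refine LayerTree.fix_zeros (q := q) ⟨t', hs'.trans hs, fun x => ?_⟩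
    rw [ht', ht, hammingWeight_cons]
    simp

theorem LayerTree.fix_ones {n s : ℕ} : ∀ {F : ℕ → ℤˣ} {p : ℕ}, LayerTree (n + p) F s →
    LayerTree n (fun w => F (w + p)) s
  | F, 0, h => h
  | F, p + 1, ⟨t, hs, ht⟩ => by
    obtain ⟨t', hs', ht'⟩ := t.exists_cons 1
    have h : LayerTree (n + p) (fun w => F (w + 1)) s := by
      refine ⟨t', hs'.trans hs, fun x => ?_⟩
      rw [ht', ht, hammingWeight_cons]
      simp
    have h' := LayerTree.fix_ones h
    simpa only [add_assoc] using h'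

theorem LayerTree.reflect {n s : ℕ} {F : ℕ → ℤˣ} (h : LayerTree n F s) :
    LayerTree n (fun w => F (n - w)) s := by
  obtain ⟨t, hs, ht⟩ := h
  obtain ⟨t', hs', ht'⟩ := t.exists_pullback (fun x : Fin n → ZMod 2 => x + 1) fun S =>
    ⟨S, S.card, fun z => by simp [Finset.sum_add_distrib]⟩
  exact ⟨t', hs'.trans hs, fun x => by rw [ht', ht, hammingWeight_add_one]⟩

theorem LayerTree.two_pow_le {n s L r : ℕ} {F : ℕ → ℤˣ} (h : LayerTree n F s) (hL : 2 ≤ L)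
    (hr : 120 * L ≤ r) (hn : 2 * r ≤ n) (hF : F (r + 1) ≠ F (r - 1)) : 2 ^ L ≤ s := by
  obtain ⟨p, rfl⟩ := Nat.exists_eq_add_of_le hr
  -- Fixing `p` ones and `q` zeros turns layer `r` into the middle layer of a cube of dimension `240
  -- * L`.
  obtain ⟨q, rfl⟩ : ∃ q, n = 2 * (120 * L) + p + q := ⟨n - 2 * (120 * L) - p, by omega⟩
  obtain ⟨t, rfl, ht⟩ := h.fix_zeros.fix_ones
  refine two_pow_le_size_of_middle_jump (F := fun w => F (w + p)) hL ht ?_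
  rwa [show 120 * L + 1 + p = 120 * L + p + 1 by ring,
    show 120 * L - 1 + p = 120 * L + p - 1 by omega]

theorem LayerTree.one_le {n s : ℕ} {F : ℕ → ℤˣ} (h : LayerTree n F s) : 1 ≤ s := by
  obtain ⟨t, rfl, -⟩ := h
  exact t.one_le_size

theorem LayerTree.two_le {n s u v : ℕ} {F : ℕ → ℤˣ} (h : LayerTree n F s) (hu : u ≤ n)
    (hv : v ≤ n) (hF : F u ≠ F v) : 2 ≤ s := by
  obtain ⟨t, rfl, ht⟩ := h
  cases t with
  | leaf c =>
    obtain ⟨x, rfl⟩ := exists_hammingWeight_eq hu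
    obtain ⟨y, rfl⟩ := exists_hammingWeight_eq hv
    exact absurd ((ht x).symm.trans (ht y)) hF
  | node S t₀ t₁ =>
    have := t₀.one_le_size
    have := t₁.one_le_size
    simp only [ParityDecisionTree.size]
    omega

/-! ### Combining the two regimes -/

/-- Since `n.choose k` is at least `(n / (2 * k)) ^ k`, the hypothesis gives `(x / 8) ^ k ≤ s` for
`x = n / (k + 1)`. As `x ≥ 64`, `x / 8` is at least the square root of `x`, and `k / 2` exceeds the
required exponent because `k ≥ 1`. -/
theorem rpow_le_of_two_mul_le {n k s : ℕ} (hk : 1 ≤ k) (hn : 64 * (k + 1) ≤ n)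
    (h : n.choose k ≤ s * 4 ^ k) :
    ((n : ℝ) / ((k + 1 : ℕ) : ℝ)) ^ ((1 / 1440 : ℝ) * ((k + 1 : ℕ) : ℝ)) ≤ s := by
  have hk0 : (0 : ℝ) < k := by exact_mod_cast hk
  have hr0 : (0 : ℝ) < ((k + 1 : ℕ) : ℝ) := by positivity
  have hkr : (k : ℝ) ≤ ((k + 1 : ℕ) : ℝ) := by exact_mod_cast k.le_succ
  have hn' : 64 * ((k + 1 : ℕ) : ℝ) ≤ n := by exact_mod_cast hn
  set x := (n : ℝ) / ((k + 1 : ℕ) : ℝ) with hx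
  have hx64 : 64 ≤ x := by rwa [hx, le_div_iff₀ hr0]
  have h1 : (n + 1 - k) ^ k ≤ s * (4 * k) ^ k := by
    calc (n + 1 - k) ^ k ≤ n.descFactorial k := Nat.pow_sub_le_descFactorial n k
      _ = k.factorial * n.choose k := Nat.descFactorial_eq_factorial_mul_choose n k
      _ ≤ k ^ k * (s * 4 ^ k) := Nat.mul_le_mul (Nat.factorial_le_pow k) h
      _ = _ := by rw [mul_pow]; ring
  have h2 : ((n : ℝ) / 2) ^ k ≤ s * (4 * k) ^ k := by
    have h3 : (((n + 1 - k : ℕ) : ℝ)) ^ k ≤ s * (4 * k) ^ k := by exact_mod_cast h1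
    refine le_trans (pow_le_pow_left₀ (by positivity) ?_ k) h3
    rw [Nat.cast_sub (by omega)]
    push_cast at hn' ⊢
    linarith
  have h3 : (x / 8) ^ k ≤ s := by
    have hle : x / 8 ≤ n / 2 / (4 * k) := by
      rw [hx, div_div, div_div, show (2 : ℝ) * (4 * k) = k * 8 by ring]
      gcongr
    refine (pow_le_pow_left₀ (by positivity) hle k).trans ?_
    rw [div_pow, div_le_iff₀ (by positivity)]
    exact h2
  have h4 : Real.sqrt x ≤ x / 8 := by
    rw [Real.sqrt_le_left (by linarith)]
    nlinarith
  refine le_trans ?_ (h3.trans' (pow_le_pow_left₀ (Real.sqrt_nonneg x) h4 k))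
  rw [Real.sqrt_eq_rpow, ← Real.rpow_natCast, ← Real.rpow_mul (by linarith)]
  refine Real.rpow_le_rpow_of_exponent_le (by linarith) ?_
  have : (1 : ℝ) ≤ k := by exact_mod_cast hk
  push_cast
  linarith

/-- The lower bound, when the left end `r` of the window is at least as far from `0` as its
right end is from `n`. -/
theorem LayerTree.rpow_le {n s r b : ℕ} {F : ℕ → ℤˣ} (h : LayerTree n F s) (hr : 1 ≤ r)
    (hb : b ≤ r) (hn : 2 * r ≤ n) (hrb : r + 1 + b ≤ n)
    (hF : ∀ w, r + 1 ≤ w → w + b ≤ n → w % 2 = (r - 1) % 2 → F w ≠ F (r - 1)) :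
    ((n : ℝ) / (r : ℝ)) ^ ((1 / 1440 : ℝ) * (r : ℝ)) ≤ s := by
  have hF1 := hF (r + 1) le_rfl hrb (by omega)
  have hr0 : (0 : ℝ) < r := by exact_mod_cast hr
  -- For `n < 64 * r = 2 ^ 6 * r` the target is at most `2 ^ (r / 240)`, whence `1440 = 6 * 240`.
  rcases le_or_gt (64 * r) n with hn64 | hn64
  · obtain ⟨k, rfl⟩ : ∃ k, r = k + 1 := ⟨r - 1, by omega⟩
    rcases Nat.eq_zero_or_pos k with rfl | hk
    · obtain ⟨t, rfl, ht⟩ := h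
      have h1 := le_size_add_two_of_isolated ht fun w h1 h2 h3 => hF w h1 (by omega) h3
      have h2 : (n : ℝ) ≤ t.size + 2 := by exact_mod_cast h1
      have h3 : (64 : ℝ) ≤ n := by exact_mod_cast hn64
      have h4 : Real.sqrt n ≤ t.size := by
        refine le_trans ?_ (by linarith : (n : ℝ) - 2 ≤ t.size)
        rw [Real.sqrt_le_left (by linarith)]
        nlinarith
      refine le_trans ?_ h4
      rw [Real.sqrt_eq_rpow]
      simp only [zero_add, Nat.cast_one, div_one, mul_one]
      exact Real.rpow_le_rpow_of_exponent_le (by linarith) (by norm_num)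
    · obtain ⟨t, rfl, ht⟩ := h
      exact rpow_le_of_two_mul_le hk hn64 (choose_le_size_mul_four_pow ht (by omega) hF)
  · have hx1 : (1 : ℝ) ≤ (n : ℝ) / r := by
      rw [le_div_iff₀ hr0, one_mul]
      exact_mod_cast (by omega : r ≤ n)
    have hx64 : (n : ℝ) / r ≤ 2 ^ (6 : ℝ) := by
      rw [div_le_iff₀ hr0]
      have : (n : ℝ) ≤ 64 * r := by exact_mod_cast hn64.le
      norm_num
      exact this
    have hpow : ((n : ℝ) / (r : ℝ)) ^ ((1 / 1440 : ℝ) * (r : ℝ)) ≤ 2 ^ ((r : ℝ) / 240) := by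
      calc _ ≤ ((2 : ℝ) ^ (6 : ℝ)) ^ ((1 / 1440 : ℝ) * (r : ℝ)) :=
            Real.rpow_le_rpow (by linarith) hx64 (by positivity)
        _ = _ := by
            rw [← Real.rpow_mul (by norm_num)]
            congr 1
            ring
    refine hpow.trans ?_
    -- The bound at a middle jump needs `L = r / 120 ≥ 2`; for smaller `r` the target is at most
    -- `2`, and a tree for a non-constant function has two leaves.
    rcases lt_or_ge r 240 with hr240 | hr240
    · have h2 : (2 : ℝ) ≤ s := by
        exact_mod_cast h.two_le (by omega) (by omega) hF1
      refine le_trans ?_ h2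
      have h3 : (r : ℝ) ≤ 240 := by exact_mod_cast hr240.le
      calc (2 : ℝ) ^ ((r : ℝ) / 240) ≤ 2 ^ (1 : ℝ) :=
            Real.rpow_le_rpow_of_exponent_le (by norm_num) (by linarith)
        _ = 2 := Real.rpow_one 2
    · have h2 := h.two_pow_le (L := r / 120) (by omega) (by omega) hn hF1
      have h3 : (2 : ℝ) ^ (r / 120) ≤ s := by exact_mod_cast h2
      refine le_trans ?_ h3
      rw [← Real.rpow_natCast]
      refine Real.rpow_le_rpow_of_exponent_le (by norm_num) ?_
      have h4 : r ≤ 240 * (r / 120) := by omega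
      have h5 : (r : ℝ) ≤ 240 * ((r / 120 : ℕ) : ℝ) := by exact_mod_cast h4
      linarith

/-! ### From minimality to a jump, and the main theorem -/

/-- Admissibility of a pair, in terms of the values on the layers. -/
def LayerAdmissible (n : ℕ) (F : ℕ → ℤˣ) (a b : ℕ) : Prop :=
  2 * a ≤ n ∧ 2 * b ≤ n ∧
    ((∀ u v, a ≤ u → u + b ≤ n → a ≤ v → v + b ≤ n → F u = F v) ∨
      ∀ u v, a ≤ u → u + b ≤ n → a ≤ v → v + b ≤ n → F u * (-1) ^ u = F v * (-1) ^ v)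

theorem isAdmissiblePair_iff {n : ℕ} {f : (Fin n → ZMod 2) → ℤˣ} {F : ℕ → ℤˣ}
    (hF : ∀ x, f x = F (hammingWeight x)) {a b : ℕ} :
    IsAdmissiblePair f (a, b) ↔ LayerAdmissible n F a b := by
  refine and_congr_right fun _ => and_congr_right fun _ => or_congr ?_ ?_
  · exact ⟨fun h => h.eq_of_le hF, fun h x y h1 h2 h3 h4 => by
      rw [hF, hF]; exact h _ _ h1 h2 h3 h4⟩
  · exact ⟨fun h => h.eq_of_le (G := fun w => F w * (-1) ^ w)
      fun x => by simp only [hF, parityFun], fun h x y h1 h2 h3 h4 => by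
        simp only [hF, parityFun]; exact h _ _ h1 h2 h3 h4⟩

/-- The reflection `w ↦ n - w` changes the parity function only by the constant factor `(-1) ^ n`.
-/
theorem LayerAdmissible.reflect {n : ℕ} {F : ℕ → ℤˣ} {a b : ℕ} (h : LayerAdmissible n F a b) :
    LayerAdmissible n (fun w => F (n - w)) b a := by
  obtain ⟨ha, hb, h | h⟩ := h
  · exact ⟨hb, ha, Or.inl fun u v _ _ _ _ =>
      h _ _ (by omega) (by omega) (by omega) (by omega)⟩
  · refine ⟨hb, ha, Or.inr fun u v _ _ _ _ => ?_⟩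
    have huv := h (n - u) (n - v) (by omega) (by omega) (by omega) (by omega)
    have hpow : ∀ w ≤ n, (-1 : ℤˣ) ^ w = (-1) ^ n * (-1) ^ (n - w) := by
      intro w hw
      rw [← pow_add, Int.units_pow_eq_pow_mod_two, Int.units_pow_eq_pow_mod_two _ (n + (n - w))]
      congr 1
      omega
    rw [hpow u (by omega), hpow v (by omega)]
    simp only [mul_left_comm _ ((-1 : ℤˣ) ^ n), huv]

/-- If layer `a - 1` agreed with a window layer of its own parity, the window could be extended to
the left, whether `f` or `f · parity` is constant on it, because the parity factor is the same on
both layers. -/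
theorem LayerAdmissible.jump {n : ℕ} {F : ℕ → ℤˣ} {a b : ℕ} (ha : 1 ≤ a)
    (h : LayerAdmissible n F a b) (hmin : ¬ LayerAdmissible n F (a - 1) b) :
    a + 1 + b ≤ n ∧
      ∀ w, a + 1 ≤ w → w + b ≤ n → w % 2 = (a - 1) % 2 → F w ≠ F (a - 1) := by
  obtain ⟨k, rfl⟩ : ∃ k, a = k + 1 := ⟨a - 1, by omega⟩
  simp only [Nat.add_sub_cancel] at *
  obtain ⟨h1, h2, h⟩ := h
  have hext : ∀ G : ℕ → ℤˣ, ∀ w₀, k + 1 ≤ w₀ → w₀ + b ≤ n →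
      (∀ u v, k + 1 ≤ u → u + b ≤ n → k + 1 ≤ v → v + b ≤ n → G u = G v) → G k = G w₀ →
      ∀ u v, k ≤ u → u + b ≤ n → k ≤ v → v + b ≤ n → G u = G v := by
    intro G w₀ h3 h4 hG hk
    have hall : ∀ u, k ≤ u → u + b ≤ n → G u = G w₀ := by
      intro u hu hu'
      rcases hu.eq_or_lt with rfl | hu
      · exact hk
      · exact hG u w₀ hu hu' h3 h4
    intro u v hu hu' hv hv'
    rw [hall u hu hu', hall v hv hv']
  -- A window of a single layer can always be extended: two adjacent values are equal, or become
  -- equal after multiplication by the parity.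
  have hsingle : k + 1 + 1 + b ≤ n := by
    by_contra hlt
    have hn : k + 1 + b ≤ n := by omega
    refine hmin ⟨by omega, h2, ?_⟩
    by_cases hk : F k = F (k + 1)
    · refine Or.inl (hext F (k + 1) le_rfl hn (fun u v _ _ _ _ => ?_) hk)
      obtain rfl : u = v := by omega
      rfl
    · refine Or.inr (hext (fun w => F w * (-1) ^ w) (k + 1) le_rfl hn
        (fun u v _ _ _ _ => ?_) ?_)
      · obtain rfl : u = v := by omega
        rfl
      · have : F k = - F (k + 1) := Int.units_ne_iff_eq_neg.mp hk
        simp [this, pow_succ]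
  refine ⟨hsingle, fun w hw hw' hpar heq => hmin ⟨by omega, h2, ?_⟩⟩
  rcases h with h | h
  · exact Or.inl (hext F w (by omega) hw' h heq.symm)
  · refine Or.inr (hext (fun w => F w * (-1) ^ w) w (by omega) hw' h ?_)
    simp only [heq]
    rw [Int.units_pow_eq_pow_mod_two, Int.units_pow_eq_pow_mod_two _ w, hpar]

theorem rpow_le_parityTreeSize {n : ℕ} {f : (Fin n → ZMod 2) → ℤˣ} (hf : IsSymmetricFun f)
    {r₀ r₁ r : ℕ} (hmin : IsMinimalPair f r₀ r₁) (hr : r = max r₀ r₁) :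
    (2 : ℝ) ^ ((1 / 1440 : ℝ) * ((r : ℝ) * Real.logb 2 ((n : ℝ) / (r : ℝ)))) ≤
      (parityTreeSize f : ℝ) := by
  obtain ⟨F, hF⟩ := hf.exists_eq_hammingWeight
  obtain ⟨t, ht, hs⟩ := exists_computes_size_eq f
  have hT : LayerTree n F (parityTreeSize f) := ⟨t, hs, fun x => (ht x).trans (hF x)⟩
  -- For `r = 0` the factor `r` makes the exponent zero whatever the junk value of the logarithm,
  -- and the bound reads `1`.
  rcases Nat.eq_zero_or_pos r with h0 | hr1
  · rw [h0]
    simpa using hT.one_le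
  have hadm : LayerAdmissible n F r₀ r₁ := (isAdmissiblePair_iff hF).mp hmin.prop
  have hnot : ∀ a b, a ≤ r₀ → b ≤ r₁ → (a < r₀ ∨ b < r₁) → ¬ LayerAdmissible n F a b := by
    intro a b ha hb hlt h
    have hle : (r₀, r₁) ≤ (a, b) :=
      hmin.le_of_le ((isAdmissiblePair_iff hF).mpr h) (Prod.mk_le_mk.mpr ⟨ha, hb⟩)
    have := Prod.mk_le_mk.mp hle
    omega
  have h2r : 2 * r ≤ n := by
    have h1 := hadm.1
    have h2 := hadm.2.1
    omega
  have hr0 : (0 : ℝ) < r := by exact_mod_cast hr1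
  have hx : (0 : ℝ) < (n : ℝ) / r :=
    div_pos (by exact_mod_cast (by omega : 0 < n)) hr0
  rw [two_rpow_mul_logb hx]
  rcases le_total r₁ r₀ with hle | hle
  · obtain rfl : r = r₀ := by rw [hr, max_eq_left hle]
    obtain ⟨h1, h2⟩ := hadm.jump hr1 (hnot _ _ (by omega) le_rfl (by omega))
    exact hT.rpow_le hr1 hle h2r h1 h2
  · obtain rfl : r = r₁ := by rw [hr, max_eq_right hle]
    have hnot' : ¬ LayerAdmissible n (fun w => F (n - w)) (r - 1) r₀ := by
      intro h
      refine hnot r₀ (r - 1) le_rfl (by omega) (by omega) ?_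
      obtain ⟨h1, h2, h3⟩ := h.reflect
      refine ⟨h1, h2, h3.imp (fun h u v hu hu' hv hv' => ?_) fun h u v hu hu' hv hv' => ?_⟩
      all_goals
        have := h u v hu hu' hv hv'
        simpa only [Nat.sub_sub_self (show u ≤ n by omega),
          Nat.sub_sub_self (show v ≤ n by omega)] using this
    obtain ⟨h1, h2⟩ := hadm.reflect.jump hr1 hnot'
    exact hT.reflect.rpow_le hr1 hle h2r h1 h2

theorem corollary2 :
    ∃ c C : ℝ, 0 < c ∧ 0 < C ∧
      ∀ (n : ℕ) (f : (Fin n → ZMod 2) → ℤˣ), IsSymmetricFun f →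
      ∀ r₀ r₁ r : ℕ, IsMinimalPair f r₀ r₁ → r = max r₀ r₁ →
        (2 : ℝ) ^ (c * ((r : ℝ) * Real.logb 2 ((n : ℝ) / (r : ℝ)))) ≤ (parityTreeSize f : ℝ) ∧
        (2 : ℝ) ^ (c * ((r : ℝ) * Real.logb 2 ((n : ℝ) / (r : ℝ)))) ≤ (decisionTreeSize f : ℝ) ∧
        (1 ≤ r → (parityTreeSize f : ℝ) ≤
          (2 : ℝ) ^ (C * ((r : ℝ) * Real.logb 2 ((n : ℝ) / (r : ℝ))))) ∧
        (r = 0 → parityTreeSize f ≤ 2) ∧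
        parityTreeSize f ≤ 4 * n.choose r₀ + 4 * n.choose r₁ := by
  refine ⟨1 / 1440, 6, by norm_num, by norm_num, fun n f hf r₀ r₁ r hmin hr => ?_⟩
  have hlow := rpow_le_parityTreeSize hf hmin hr
  refine ⟨hlow, hlow.trans (by exact_mod_cast parityTreeSize_le_decisionTreeSize f),
    fun hr1 => parityTreeSize_le_rpow hf hmin.prop hr hr1, fun h0 => ?_,
    parityTreeSize_le_choose hf hmin.prop⟩
  obtain ⟨rfl, rfl⟩ : r₀ = 0 ∧ r₁ = 0 := by omega
  exact parityTreeSize_le_two hmin.prop
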